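/- Let $b\ge 1$ and let $U$ be a Clifford unitary on $b$ qubits, i.e. a unitary with $UPU^\dagger\in\mathcal P_b$ for all $P\in\mathcal P_b$, where $\mathcal P_b=\{\eta\,P_1\otimes\cdots\otimes P_b:\ \eta\in\{\pm1,\pm i\},\ P_j\in\{I,X,Y,Z\}\}$. Let $V:\mathbb C^2\to(\mathbb C^2)^{\otimes b}$, $V|\psi\rangle=U(|\psi\rangle\otimes|0\rangle^{\otimes(b-1)})$, be the corresponding encoder of a stabilizer code (the image of $V$), and let $\mathcal V(\rho)=V\rho V^\dagger$. For $p_x,p_z\in[0,1]$ let $\mathcal N=\mathcal N_x\circ\mathcal N_z$ with $\mathcal N_x(\rho)=(1-p_x)\rho+p_xX\rho X$ and $\mathcal N_z(\rho)=(1-p_z)\rho+p_zZ\rho Z$, and for $T\ge0$ let $$\mathcal E_T=\big(\mathcal N^{\otimes b^{T}}\circ\mathcal V^{\otimes b^{T-1}}\big)\circ\cdots\circ\big(\mathcal N^{\otimes b^{2}}\circ\mathcal V^{\otimes b}\big)\circ\big(\mathcal N^{\otimes b}\circ\mathcal V\big)$$ be the noisy tree channel from $1$ qubit to $b^T$ qubits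 ($\mathcal E_0=\mathrm{id}$). Let $\mathcal D_z(\rho)=(\rho+Z\rho Z)/2$. For a superoperator $\Phi$ on a system $S$ let $\|\Phi\|_\diamond=\max_{\rho}\|(\Phi\otimes\mathrm{id}_R)(\rho)\|_1$, where $R$ is a copy of $S$, $\rho$ ranges over the density operators of $SR$, and $\|\cdot\|_1$ is the trace norm. Suppose that $Z_L\in\mathcal P_b$ satisfies $VZ=Z_LV$ and is, up to a phase in $\{\pm1,\pm i\}$, a tensor product of Pauli $Z$ and identity operators; let $b_z$ be its weight, the number of qubits on which it acts as a multiple of $Z$. Then, for every $T\ge 0$, $$\|\mathcal E_T-\mathcal E_T\circ\mathcal D_z\|_\diamond\le\sqrt2\,\big(\sqrt{b_z}\,|1-2p_z|\big)^T .$$ Consequently, with $|\pm\rangle=(|0\rangle\pm|1\rangle)/\sqrt2$, for every $T\ge 0$, $$\big\|\mathcal E_T(|+\rangle\langle+|)-\mathcal E_T(|-\rangle\langle-|)\big\|_1\le 2\sqrt2\,\big(\sqrt{b_z}\,|1-2p_z|\big)^T ,$$ and if $(1-b_z^{-1/2})/2<p_z<(1+b_z^{-1/2})/2$, then $\sqrt{b_z}\,|1-2p_z|<1$,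 so that both quantities decay exponentially with the depth $T$; in particular $\|\mathcal E_T-\mathcal E_T\circ\mathcal D_z\|_\diamond\to0$ as $T\to\infty$. Moreover, an encoder to which this applies exists for every such code: for every Clifford unitary $U$ on $b$ qubits there is a Clifford unitary $U'$ on $b$ qubits whose encoder has the same image as that of $U$ and which has a logical operator $Z_L$ of the above form. -/

import Mathlib

open scoped Matrix ENNReal ComplexOrder

noncomputable section

/-! ### Qubits, operators and superoperators

A single qubit has the index set `Fin 2`, a register of `n` qubits has the index set
`Fin n → Fin 2` (the computational basis). Operators are complex matrices over these index
sets, superoperators are complex-linear maps between spaces of matrices. -/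

/-- Linear maps taking operators on a system with basis `m` to operators on one with basis `k`. -/
abbrev SuperOp (m k : Type) := Matrix m m ℂ →ₗ[ℂ] Matrix k k ℂ

/-- The superoperator `ρ ↦ A ρ A†`. -/
def conjBy {m k : Type} [Fintype m] (A : Matrix k m ℂ) : SuperOp m k where
  toFun ρ := A * ρ * Aᴴ
  map_add' ρ σ := by rw [Matrix.mul_add, Matrix.add_mul]
  map_smul' c ρ := by simp

/-- The tensor power `Φ^{⊗ n}`: in matrix units `|y⟩⟨y'|`, its value is the tensor product over
the `n` factors of `Φ (|y i⟩⟨y' i|)`. -/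
def tensorPow {m k : Type} [Fintype m] [DecidableEq m] (n : ℕ) (Φ : SuperOp m k) :
    SuperOp (Fin n → m) (Fin n → k) where
  toFun ρ := Matrix.of fun x x' => ∑ y : Fin n → m, ∑ y' : Fin n → m,
    (∏ i, Φ (Matrix.single (y i) (y' i) 1) (x i) (x' i)) * ρ y y'
  map_add' ρ σ := by
    ext x x'
    simp [mul_add, Finset.sum_add_distrib]
  map_smul' c ρ := by
    ext x x'
    simp [Finset.mul_sum, mul_left_comm]

/-- `Φ ⊗ id_R`, where the reference system `R` has basis `r`. -/
def tensorId {m k : Type} (r : Type) (Φ : SuperOp m k) : SuperOp (m × r) (k × r) where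
  toFun ρ := Matrix.of fun x x' =>
    Φ (Matrix.of fun a a' => ρ (a, x.2) (a', x'.2)) x.1 x'.1
  map_add' ρ σ := by
    ext x x'
    have h : (Matrix.of fun a a' => (ρ + σ) (a, x.2) (a', x'.2)) =
        (Matrix.of fun a a' => ρ (a, x.2) (a', x'.2)) +
          (Matrix.of fun a a' => σ (a, x.2) (a', x'.2)) := by
      ext a a'; simp
    change Φ (Matrix.of fun a a' => (ρ + σ) (a, x.2) (a', x'.2)) x.1 x'.1 = _
    rw [h, map_add]
    rfl
  map_smul' c ρ := by
    ext x x'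
    have h : (Matrix.of fun a a' => (c • ρ) (a, x.2) (a', x'.2)) =
        c • (Matrix.of fun a a' => ρ (a, x.2) (a', x'.2)) := by
      ext a a'; simp
    change Φ (Matrix.of fun a a' => (c • ρ) (a, x.2) (a', x'.2)) x.1 x'.1 = _
    rw [h, map_smul]
    rfl

/-! ### Trace norm and diamond norm -/

/-- The trace norm `‖A‖₁ = tr √(A† A)`, the sum of the singular values of `A`. -/
def traceNorm {m : Type} [Fintype m] [DecidableEq m] (A : Matrix m m ℂ) : ℝ :=
  ∑ i, Real.sqrt ((Matrix.isHermitian_conjTranspose_mul_self A).eigenvalues i)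

/-- Density operators: positive semidefinite with unit trace. -/
def IsDensity {m : Type} [Fintype m] (ρ : Matrix m m ℂ) : Prop :=
  ρ.PosSemidef ∧ ρ.trace = 1

/-- The diamond norm: the supremum of `‖(Φ ⊗ id_R) ρ‖₁` over all states `ρ` of `S R`, where the
reference `R` is a copy of the input system `S`. It takes values in `[0, ∞]`, so that no
boundedness is needed to define the supremum. -/
def diamondNorm {m k : Type} [Fintype m] [DecidableEq m] [Fintype k] [DecidableEq k]
    (Φ : SuperOp m k) : ℝ≥0∞ :=
  ⨆ (ρ : Matrix (m × m) (m × m) ℂ) (_ : IsDensity ρ),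
    ENNReal.ofReal (traceNorm (tensorId m Φ ρ))

/-! ### Pauli operators and Clifford unitaries -/

/-- Labels of the four single-qubit Pauli matrices. -/
inductive Pauli
  | I | X | Y | Z
  deriving DecidableEq

/-- The single-qubit Pauli matrices. -/
def Pauli.mat : Pauli → Matrix (Fin 2) (Fin 2) ℂ
  | .I => 1
  | .X => !![0, 1; 1, 0]
  | .Y => !![0, -Complex.I; Complex.I, 0]
  | .Z => !![1, 0; 0, -1]

/-- The elements of the `n`-qubit Pauli group: a phase in `{±1, ±i}` and one label per qubit. -/
structure PauliOp (n : ℕ) where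
  phase : ℂ
  phase_pow : phase ^ 4 = 1
  label : Fin n → Pauli

/-- The operator `η P₁ ⊗ ⋯ ⊗ Pₙ`. -/
def PauliOp.mat {n : ℕ} (P : PauliOp n) : Matrix (Fin n → Fin 2) (Fin n → Fin 2) ℂ :=
  Matrix.of fun x y => P.phase * ∏ j, (P.label j).mat (x j) (y j)

/-- The number of qubits on which `P` is not a multiple of the identity. -/
def PauliOp.weight {n : ℕ} (P : PauliOp n) : ℕ :=
  (Finset.univ.filter fun j => P.label j ≠ Pauli.I).card

/-- `P` is, up to a phase, a tensor product of Pauli `Z` and identity operators. -/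
def PauliOp.IsZType {n : ℕ} (P : PauliOp n) : Prop :=
  ∀ j, P.label j = Pauli.I ∨ P.label j = Pauli.Z

/-- Clifford unitaries: unitaries that map the Pauli group into itself by conjugation. -/
def IsClifford {n : ℕ} (U : Matrix (Fin n → Fin 2) (Fin n → Fin 2) ℂ) : Prop :=
  U ∈ Matrix.unitaryGroup (Fin n → Fin 2) ℂ ∧
    ∀ P : PauliOp n, ∃ Q : PauliOp n, U * P.mat * Uᴴ = Q.mat

/-! ### Encoders -/

/-- The encoder `V |ψ⟩ = U (|ψ⟩ |0⟩^{⊗ (b-1)})` (for `b ≥ 1`): the column of `V` at `|a⟩` is the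
column of `U` at `|a 0 ⋯ 0⟩`. -/
def encoder {b : ℕ} (U : Matrix (Fin b → Fin 2) (Fin b → Fin 2) ℂ) :
    Matrix (Fin b → Fin 2) (Fin 2) ℂ :=
  Matrix.of fun x a => U x (fun j => if j.val = 0 then a else 0)

/-- The code subspace of an encoder, which is its image. -/
def codeSpace {b : ℕ} (V : Matrix (Fin b → Fin 2) (Fin 2) ℂ) :
    Submodule ℂ ((Fin b → Fin 2) → ℂ) :=
  LinearMap.range V.mulVecLin

/-- `L` is a logical `Z` operator of the encoder `V`: `V Z = L V`. -/
def IsLogicalZ {b : ℕ} (V : Matrix (Fin b → Fin 2) (Fin 2) ℂ) (L : PauliOp b) : Prop :=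
  V * Pauli.Z.mat = L.mat * V

/-! ### Noise and the tree channel -/

/-- The bit-flip channel `ρ ↦ (1 - p) ρ + p X ρ X`. -/
def bitFlip (p : ℝ) : SuperOp (Fin 2) (Fin 2) :=
  ((1 - p : ℝ) : ℂ) • LinearMap.id + (p : ℂ) • conjBy Pauli.X.mat

/-- The phase-flip channel `ρ ↦ (1 - p) ρ + p Z ρ Z`. -/
def phaseFlip (p : ℝ) : SuperOp (Fin 2) (Fin 2) :=
  ((1 - p : ℝ) : ℂ) • LinearMap.id + (p : ℂ) • conjBy Pauli.Z.mat

/-- The fully dephasing channel `ρ ↦ (ρ + Z ρ Z) / 2`. -/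
def dephase : SuperOp (Fin 2) (Fin 2) :=
  (1 / 2 : ℂ) • (LinearMap.id + conjBy Pauli.Z.mat)

/-- A list of `b ^ t` blocks of `b` qubits each is a register of `b ^ (t + 1)` qubits: qubit `i`
of block `v` becomes qubit `b v + i`. -/
def regroupEquiv (b t : ℕ) :
    (Fin (b ^ t) → Fin b → Fin 2) ≃ (Fin (b ^ (t + 1)) → Fin 2) :=
  (Equiv.curry (Fin (b ^ t)) (Fin b) (Fin 2)).symm.trans
    (Equiv.arrowCongr
      (finProdFinEquiv.trans (finCongr (pow_succ b t).symm)) (Equiv.refl (Fin 2)))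

/-- One qubit is a register of `b ^ 0` qubits. -/
def rootEquiv (b : ℕ) : Fin 2 ≃ (Fin (b ^ 0) → Fin 2) :=
  (Equiv.funUnique (Fin 1) (Fin 2)).symm.trans
    (Equiv.arrowCongr (finCongr (pow_zero b).symm) (Equiv.refl (Fin 2)))

/-- Renaming the basis of a system. -/
def relabel {m k : Type} (e : m ≃ k) : SuperOp m k :=
  (Matrix.reindexLinearEquiv ℂ ℂ e e).toLinearMap

/-- The noisy tree channel
`E_T = (N^{⊗ b^T} ∘ 𝒱^{⊗ b^(T-1)}) ∘ ⋯ ∘ (N^{⊗ b} ∘ 𝒱)` from one qubit to `b ^ T` qubits,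
where `𝒱 ρ = V ρ V†`. There is no noise on the root. -/
def treeChannel {b : ℕ} (V : Matrix (Fin b → Fin 2) (Fin 2) ℂ) (N : SuperOp (Fin 2) (Fin 2)) :
    (T : ℕ) → SuperOp (Fin 2) (Fin (b ^ T) → Fin 2)
  | 0 => relabel (rootEquiv b)
  | T + 1 => tensorPow (b ^ (T + 1)) N ∘ₗ relabel (regroupEquiv b T) ∘ₗ
      tensorPow (b ^ T) (conjBy V) ∘ₗ treeChannel V N T

/-- The tree channel of the encoder defined by `U`, where the noise on each edge is the composition
of a bit-flip channel of probability `px` and a phase-flip channel of probability `pz`. -/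
def stabilizerTree {b : ℕ} (U : Matrix (Fin b → Fin 2) (Fin b → Fin 2) ℂ) (px pz : ℝ) (T : ℕ) :
    SuperOp (Fin 2) (Fin (b ^ T) → Fin 2) :=
  treeChannel (encoder U) (bitFlip px ∘ₗ phaseFlip pz) T

/-- The state `|+⟩⟨+|`, where `|+⟩ = (|0⟩ + |1⟩) / √2`. -/
def plusState : Matrix (Fin 2) (Fin 2) ℂ := !![1 / 2, 1 / 2; 1 / 2, 1 / 2]

/-- The state `|-⟩⟨-|`, where `|-⟩ = (|0⟩ - |1⟩) / √2`. -/
def minusState : Matrix (Fin 2) (Fin 2) ℂ := !![1 / 2, -(1 / 2); -(1 / 2), 1 / 2]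

end

noncomputable section

open scoped Kronecker

/-! The proof follows what the environment learns about the `Z` value of the input. Let `Φ` have
Kraus operators `K a`, and let `u` be a Hermitian unitary on the environment with `∑ u a a' • (K a)ᴴ
* K a' = c • Z`; this is `HasPhaseRecord Φ c`. If `c ^ 2` is near 1, the environment nearly measures
`Z`, so `Φ` nearly forgets the phase. Quantitatively, the operators `∑ l, u k l • (K l * Z)` are
Kraus operators of `ρ ↦ Φ (Z ρ Z)` by unitary freedom, and their overlap with `K` is `c • 1`. A
polarization identity and Cauchy–Schwarz then bound the trace distance by `2 √(1 - c²)`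
(`traceNorm_kraus_sub_le`, `traceNorm_sub_flip_le`), also in the presence of a reference system.

It remains to bound the defect `1 - c²` along the tree. Bit flips cost nothing, since the
environment knows whether a flip occurred and corrects the sign. Phase flips leave a record of their
own, and the best combination with the old one multiplies the defect by `(1 - 2 pz)²`
(`HasPhaseRecord.exists_comp_noise`). Since `Z_L` is of `Z` type, the product of the records of the
subtrees in its support is a record for the encoded qubit, with bias `c ^ weight`
(`hasPhaseRecord_tensor`); by Bernoulli's inequality the defect grows at most by the factor
`weight`. Starting from `c = 0` this gives `1 - c² ≤ (weight (1 - 2 pz)²) ^ T`. The induction adds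
levels at the root, whereas `treeChannel` adds them at the leaves; `treeChannel_succ` reconciles the
two.

For the existence of the encoder, `Z` strings span the diagonal operators, so some `Z` string has a
non-scalar compression to the code. Pulled back through `U` it is a Pauli operator acting as a
nontrivial Pauli on the input qubit and fixing the zero ancillas up to phase. A single-qubit
Clifford in front of `U` turns that Pauli into `Z`. -/

/-! ### Tensor products of matrices and tensor powers of superoperators. -/

/-- The tensor product of a family of matrices. -/
def tens {ι m k : Type} [Fintype ι] (A : ι → Matrix k m ℂ) : Matrix (ι → k) (ι → m) ℂ :=
  Matrix.of fun x y => ∏ i, A i (x i) (y i)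

theorem prod_sum_pi {ι κ : Type} [Fintype ι] [DecidableEq ι] [Fintype κ] (f : ι → κ → ℂ) :
    ∏ i, ∑ k, f i k = ∑ p : ι → κ, ∏ i, f i (p i) := by
  rw [Finset.prod_univ_sum, Fintype.piFinset_univ]

theorem prod_sum_sum_pi {ι κ : Type} [Fintype ι] [DecidableEq ι] [Fintype κ]
    (f : ι → κ → κ → ℂ) :
    ∏ i, ∑ k, ∑ l, f i k l = ∑ p : ι → κ, ∑ q : ι → κ, ∏ i, f i (p i) (q i) := by
  simp_rw [prod_sum_pi]

theorem tens_mul {ι m k l : Type} [Fintype ι] [DecidableEq ι] [Fintype m]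
    (A : ι → Matrix k m ℂ) (B : ι → Matrix m l ℂ) :
    tens A * tens B = tens fun i => A i * B i := by
  ext x y
  simp only [tens, Matrix.mul_apply, Matrix.of_apply, prod_sum_pi, Finset.prod_mul_distrib]

theorem tens_conjTranspose {ι m k : Type} [Fintype ι] (A : ι → Matrix k m ℂ) :
    (tens A)ᴴ = tens fun i => (A i)ᴴ := by
  ext x y
  simp [tens, Matrix.conjTranspose_apply]

theorem tens_one {ι m : Type} [Fintype ι] [DecidableEq ι] [DecidableEq m] :
    (tens fun _ : ι => (1 : Matrix m m ℂ)) = 1 := by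
  ext x y
  simp only [tens, Matrix.of_apply, Matrix.one_apply, Finset.prod_ite_zero, Finset.prod_const_one,
    Finset.mem_univ, true_imp_iff, funext_iff]

/-- The tensor power of a superoperator over an arbitrary finite index type. -/
def tpow {m k : Type} [Fintype m] [DecidableEq m] (ι : Type) [Fintype ι] [DecidableEq ι]
    (Φ : SuperOp m k) : SuperOp (ι → m) (ι → k) where
  toFun ρ := Matrix.of fun x x' => ∑ y : ι → m, ∑ y' : ι → m,
    (∏ i, Φ (Matrix.single (y i) (y' i) 1) (x i) (x' i)) * ρ y y'
  map_add' ρ σ := by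
    ext x x'
    simp [mul_add, Finset.sum_add_distrib]
  map_smul' c ρ := by
    ext x x'
    simp [Finset.mul_sum, mul_left_comm]

theorem tpow_apply {m k ι : Type} [Fintype m] [DecidableEq m] [Fintype ι] [DecidableEq ι]
    (Φ : SuperOp m k) (ρ : Matrix (ι → m) (ι → m) ℂ) (x x' : ι → k) :
    tpow ι Φ ρ x x' = ∑ y : ι → m, ∑ y' : ι → m,
      (∏ i, Φ (Matrix.single (y i) (y' i) 1) (x i) (x' i)) * ρ y y' := rfl

theorem superOp_apply_eq_sum {m k : Type} [Fintype m] [DecidableEq m] (Φ : SuperOp m k)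
    (ρ : Matrix m m ℂ) (x x' : k) :
    Φ ρ x x' = ∑ y, ∑ y', Φ (Matrix.single y y' 1) x x' * ρ y y' := by
  conv_lhs => rw [Matrix.matrix_eq_sum_single ρ]
  simp only [map_sum, Matrix.sum_apply]
  refine Finset.sum_congr rfl fun y _ => Finset.sum_congr rfl fun y' _ => ?_
  rw [show Matrix.single y y' (ρ y y') = ρ y y' • Matrix.single y y' (1 : ℂ) by simp, map_smul,
    Matrix.smul_apply, smul_eq_mul, mul_comm]

theorem superOp_ext {m k : Type} [Fintype m] [DecidableEq m] {Φ Ψ : SuperOp m k}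
    (h : ∀ y y' x x', Φ (Matrix.single y y' 1) x x' = Ψ (Matrix.single y y' 1) x x') : Φ = Ψ := by
  ext ρ x x'
  rw [superOp_apply_eq_sum Φ, superOp_apply_eq_sum Ψ]
  simp only [h]

theorem tpow_single {m k ι : Type} [Fintype m] [DecidableEq m] [Fintype ι] [DecidableEq ι]
    (Φ : SuperOp m k) (y y' : ι → m) (x x' : ι → k) :
    tpow ι Φ (Matrix.single y y' 1) x x' = ∏ i, Φ (Matrix.single (y i) (y' i) 1) (x i) (x' i) := by
  rw [tpow_apply, Finset.sum_eq_single y, Finset.sum_eq_single y',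
    Matrix.single_apply_same, mul_one]
  · intro b _ hb
    simp [hb.symm]
  · simp
  · intro b _ hb
    simp [hb.symm]
  · simp

theorem tpow_comp {m k l ι : Type} [Fintype m] [DecidableEq m] [Fintype k] [DecidableEq k]
    [Fintype ι] [DecidableEq ι] (Ψ : SuperOp k l) (Φ : SuperOp m k) :
    tpow ι (Ψ ∘ₗ Φ) = tpow ι Ψ ∘ₗ tpow ι Φ := by
  refine superOp_ext fun y y' x x' => ?_
  rw [tpow_single, LinearMap.comp_apply, tpow_apply]
  simp only [LinearMap.comp_apply, tpow_single, ← Finset.prod_mul_distrib]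
  rw [← prod_sum_sum_pi fun i a b => Ψ (Matrix.single a b 1) (x i) (x' i) *
    Φ (Matrix.single (y i) (y' i) 1) a b]
  exact Finset.prod_congr rfl fun i _ => superOp_apply_eq_sum _ _ _ _

/-! ### Regrouping of registers and the recursion of the tree at its root. -/

theorem relabel_apply {m k : Type} (e : m ≃ k) (ρ : Matrix m m ℂ) (x x' : k) :
    relabel e ρ x x' = ρ (e.symm x) (e.symm x') := rfl

theorem relabel_trans {m k l : Type} (e : m ≃ k) (f : k ≃ l) :
    relabel f ∘ₗ relabel e = relabel (e.trans f) := rfl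

theorem relabel_single {m k : Type} [DecidableEq m] [DecidableEq k] (e : m ≃ k) (y y' : m) :
    relabel e (Matrix.single y y' 1) = Matrix.single (e y) (e y') 1 := by
  ext x x'
  simp [relabel_apply, Matrix.single_apply, Equiv.eq_symm_apply]

theorem tpow_relabel {m k ι : Type} [Fintype m] [DecidableEq m] [DecidableEq k] [Fintype ι]
    [DecidableEq ι] (e : m ≃ k) :
    tpow ι (relabel e) = relabel (Equiv.piCongrRight fun _ => e) := by
  refine superOp_ext fun y y' x x' => ?_
  rw [tpow_single]
  simp only [relabel_apply, Matrix.single_apply, Finset.prod_ite_zero, Finset.prod_const_one,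
    Finset.mem_univ, true_imp_iff]
  simp [funext_iff, forall_and]

/-- Joining `ι` blocks indexed by `κ` to one register. -/
def assemble {ι κ μ : Type} (f : ι × κ ≃ μ) (m : Type) : (ι → κ → m) ≃ (μ → m) :=
  (Equiv.curry ι κ m).symm.trans (Equiv.arrowCongr f (Equiv.refl m))

/-- Naturality of regrouping: on matrix units both sides are the same product, taken over `μ` or
iterated over `ι` and `κ`. -/
theorem tpow_comp_assemble {m k ι κ μ : Type} [Fintype m] [DecidableEq m]
    [Fintype ι] [DecidableEq ι] [Fintype κ] [DecidableEq κ] [Fintype μ] [DecidableEq μ]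
    (f : ι × κ ≃ μ) (Φ : SuperOp m k) :
    tpow μ Φ ∘ₗ relabel (assemble f m) = relabel (assemble f k) ∘ₗ tpow ι (tpow κ Φ) := by
  refine superOp_ext fun y y' x x' => ?_
  rw [LinearMap.comp_apply, LinearMap.comp_apply, relabel_single, tpow_single, relabel_apply,
    tpow_single]
  simp only [tpow_single]
  rw [← Fintype.prod_prod_type', ← f.prod_comp]
  simp [assemble]
  rfl

/-- A system is a register of length one. -/
def unitEquiv (b : ℕ) (m : Type) : m ≃ (Fin (b ^ 0) → m) :=
  (Equiv.funUnique (Fin 1) m).symm.trans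
    (Equiv.arrowCongr (finCongr (pow_zero b).symm) (Equiv.refl m))

theorem tpow_comp_unitEquiv {m k : Type} [Fintype m] [DecidableEq m] (b : ℕ) (Φ : SuperOp m k) :
    tpow (Fin (b ^ 0)) Φ ∘ₗ relabel (unitEquiv b m) = relabel (unitEquiv b k) ∘ₗ Φ := by
  refine superOp_ext fun y y' x x' => ?_
  rw [LinearMap.comp_apply, LinearMap.comp_apply, relabel_single, tpow_single, relabel_apply,
    ← (finCongr (pow_zero b).symm).prod_comp]
  simp [unitEquiv]
  rfl

/-- The position of leaf `v` of the `i`-th subtree of the root. -/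
def subtreeEquiv (b T : ℕ) : Fin b × Fin (b ^ T) ≃ Fin (b ^ (T + 1)) :=
  finProdFinEquiv.trans (finCongr (pow_succ' b T).symm)

/-- Both routes send child `j` of node `v` of subtree `i` to the same leaf, because `b (v + b ^ T i)
+ j = (b v + j) + b ^ (T + 1) i`. -/
theorem relabel_regroup_comp_subtree (b T : ℕ) :
    relabel (regroupEquiv b (T + 1)) ∘ₗ relabel (assemble (subtreeEquiv b T) (Fin b → Fin 2)) =
      relabel (assemble (subtreeEquiv b (T + 1)) (Fin 2)) ∘ₗ
        relabel (Equiv.piCongrRight fun _ => regroupEquiv b T) := by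
  rw [relabel_trans, relabel_trans]
  congr 1
  apply Equiv.symm_bijective.injective
  ext x i v j : 4
  simp only [Equiv.symm_trans_apply, regroupEquiv, assemble, subtreeEquiv]
  simp
  congr 1
  ext
  simp
  ring

theorem relabel_regroup_comp_unit (b : ℕ) :
    relabel (regroupEquiv b 0) ∘ₗ relabel (unitEquiv b (Fin b → Fin 2)) =
      relabel (assemble (subtreeEquiv b 0) (Fin 2)) ∘ₗ
        relabel (Equiv.piCongrRight fun _ => rootEquiv b) := by
  rw [relabel_trans, relabel_trans]
  congr 1
  apply Equiv.symm_bijective.injective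
  ext x i : 2
  simp only [Equiv.symm_trans_apply, regroupEquiv, assemble, subtreeEquiv, unitEquiv, rootEquiv]
  -- Both placeholders are the only element of `Fin (b ^ 0)`, so each address reduces to `i`.
  change x (finCongr (pow_succ b 0).symm (finProdFinEquiv (_, i))) =
    x (finCongr (pow_succ' b 0).symm (finProdFinEquiv (i, _)))
  congr 1
  ext
  change (i : ℕ) + b * 0 = 0 + b ^ 0 * (i : ℕ)
  simp

/-- The tree of depth `T + 1` consists of `b` trees of depth `T` joined at the root. -/
theorem treeChannel_succ {b : ℕ} (V : Matrix (Fin b → Fin 2) (Fin 2) ℂ)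
    (N : SuperOp (Fin 2) (Fin 2)) (T : ℕ) :
    treeChannel V N (T + 1) = relabel (assemble (subtreeEquiv b T) (Fin 2)) ∘ₗ
      tpow (Fin b) (treeChannel V N T ∘ₗ N) ∘ₗ conjBy V := by
  induction T with
  | zero =>
    have h := tpow_comp_unitEquiv b (conjBy V)
    have hN : relabel (rootEquiv b) ∘ₗ N = tpow (Fin (b ^ 0)) N ∘ₗ relabel (rootEquiv b) :=
      (tpow_comp_unitEquiv b N).symm
    change tpow (Fin (b ^ 1)) N ∘ₗ relabel (regroupEquiv b 0) ∘ₗ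
      tpow (Fin (b ^ 0)) (conjBy V) ∘ₗ relabel (unitEquiv b (Fin 2)) = relabel _ ∘ₗ
      tpow (Fin b) (relabel (rootEquiv b) ∘ₗ N) ∘ₗ conjBy V
    have h2 := tpow_comp_assemble (subtreeEquiv b 0) N
    have h3 := relabel_regroup_comp_unit b
    simp only [h, hN, LinearMap.comp_assoc, tpow_comp, tpow_relabel]
    ext1 ρ
    replace h2 := fun ρ => LinearMap.congr_fun h2 ρ
    replace h3 := fun ρ => LinearMap.congr_fun h3 ρ
    simp only [LinearMap.comp_apply] at h2 h3 ⊢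
    rw [h3, ← h2]
  | succ T ih =>
    change tpow (Fin (b ^ (T + 2))) N ∘ₗ relabel (regroupEquiv b (T + 1)) ∘ₗ
      tpow (Fin (b ^ (T + 1))) (conjBy V) ∘ₗ treeChannel V N (T + 1) = relabel _ ∘ₗ
      tpow (Fin b) ((tpow (Fin (b ^ (T + 1))) N ∘ₗ relabel (regroupEquiv b T) ∘ₗ
      tpow (Fin (b ^ T)) (conjBy V) ∘ₗ treeChannel V N T) ∘ₗ N) ∘ₗ conjBy V
    rw [ih]
    have h1 := tpow_comp_assemble (subtreeEquiv b T) (conjBy V)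
    have h2 := tpow_comp_assemble (subtreeEquiv b (T + 1)) N
    have h3 := relabel_regroup_comp_subtree b T
    simp only [LinearMap.comp_assoc, tpow_comp, tpow_relabel]
    ext1 ρ
    replace h1 := fun ρ => LinearMap.congr_fun h1 ρ
    replace h2 := fun ρ => LinearMap.congr_fun h2 ρ
    replace h3 := fun ρ => LinearMap.congr_fun h3 ρ
    simp only [LinearMap.comp_apply] at h1 h2 h3 ⊢
    -- The encoders, the regrouping and the noise of the last level pass in turn through the joining
    -- of the subtrees.
    rw [h1, h3, h2]

/-! ### Trace norm, Hilbert–Schmidt norm and the distance of channels with given Kraus overlap. -/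

/-- The squared Hilbert-Schmidt norm. -/
def hsSq {m k : Type} [Fintype m] [Fintype k] (A : Matrix m k ℂ) : ℝ :=
  ∑ i, ∑ j, ‖A i j‖ ^ 2

theorem hsSq_nonneg {m k : Type} [Fintype m] [Fintype k] (A : Matrix m k ℂ) : 0 ≤ hsSq A :=
  Finset.sum_nonneg fun _ _ => Finset.sum_nonneg fun _ _ => by positivity

theorem hsSq_eq_trace {m k : Type} [Fintype m] [Fintype k] (A : Matrix m k ℂ) :
    (hsSq A : ℂ) = (Aᴴ * A).trace := by
  simp only [hsSq, Matrix.trace, Matrix.diag, Matrix.mul_apply, Matrix.conjTranspose_apply]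
  rw [Finset.sum_comm]
  push_cast
  refine Finset.sum_congr rfl fun i _ => Finset.sum_congr rfl fun j _ => ?_
  rw [← Complex.conj_mul', starRingEnd_apply]

theorem trace_mul_conjTranspose_re_le {m k : Type} [Fintype m] [Fintype k]
    (A B : Matrix m k ℂ) : (A * Bᴴ).trace.re ≤ √(hsSq A) * √(hsSq B) := by
  have h : (A * Bᴴ).trace = ∑ p : m × k, A p.1 p.2 * star (B p.1 p.2) := by
    simp [Matrix.trace, Matrix.mul_apply, Fintype.sum_prod_type]
  have hs (C : Matrix m k ℂ) : hsSq C = ∑ p : m × k, ‖C p.1 p.2‖ ^ 2 := by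
    simp [hsSq, Fintype.sum_prod_type]
  rw [h, hs, hs]
  refine (Complex.re_le_norm _).trans ((norm_sum_le _ _).trans ?_)
  simp only [norm_mul, norm_star]
  exact Real.sum_mul_le_sqrt_mul_sqrt _ _ _

/-- The trace norm is attained on a contraction. -/
theorem exists_contraction_traceNorm {m : Type} [Fintype m] [DecidableEq m] (M : Matrix m m ℂ) :
    ∃ G : Matrix m m ℂ, (1 - Gᴴ * G).PosSemidef ∧ traceNorm M = (G * M).trace.re := by
  have h := Matrix.isHermitian_conjTranspose_mul_self M
  set v : Matrix m m ℂ := (h.eigenvectorUnitary : Matrix m m ℂ) with hv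
  -- As `0⁻¹ = 0`, conjugating `D` by `v` gives the pseudo-inverse of `√(Mᴴ * M)`, also for singular
  -- `M`.
  set D : Matrix m m ℂ := Matrix.diagonal fun i => ((√(h.eigenvalues i) : ℂ))⁻¹ with hD
  set E : Matrix m m ℂ := Matrix.diagonal fun i => (h.eigenvalues i : ℂ) with hE
  have hpos : ∀ i, 0 ≤ h.eigenvalues i :=
    (Matrix.posSemidef_conjTranspose_mul_self M).eigenvalues_nonneg
  have hvv : vᴴ * v = 1 := Matrix.mem_unitaryGroup_iff'.mp h.eigenvectorUnitary.2
  have hdiag : vᴴ * (Mᴴ * M) * v = E := by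
    have := h.conjStarAlgAut_star_eigenvectorUnitary
    rw [Unitary.conjStarAlgAut_star_apply] at this
    exact this
  have hDD : Dᴴ = D := by
    rw [hD, Matrix.diagonal_conjTranspose]
    congr 1
    ext i
    simp
  have hDE : D * D * E * (D * D) = D * D := by
    simp only [hD, hE, Matrix.diagonal_mul_diagonal]
    congr 1
    ext i
    rcases (hpos i).eq_or_lt with h0 | h0
    · simp [← h0]
    · have h1 : (h.eigenvalues i : ℂ) = √(h.eigenvalues i) * √(h.eigenvalues i) := by
        rw [← Complex.ofReal_mul, Real.mul_self_sqrt h0.le]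
      have h2 : (√(h.eigenvalues i) : ℂ) ≠ 0 := by
        rw [Complex.ofReal_ne_zero]
        exact (Real.sqrt_pos.mpr h0).ne'
      rw [h1]
      field_simp
  -- This is the adjoint of the partial isometry in the polar decomposition of `M`; below, `Gᴴ * G`
  -- is the projection `P`.
  refine ⟨v * D * vᴴ * Mᴴ, ?_, ?_⟩
  · set P : Matrix m m ℂ := M * v * (D * D) * vᴴ * Mᴴ with hP
    have hG : (v * D * vᴴ * Mᴴ)ᴴ * (v * D * vᴴ * Mᴴ) = P := by
      simp only [Matrix.conjTranspose_mul, Matrix.conjTranspose_conjTranspose, hDD]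
      calc M * (v * (D * vᴴ)) * (v * D * vᴴ * Mᴴ) = M * v * D * (vᴴ * v) * D * vᴴ * Mᴴ := by
            simp only [Matrix.mul_assoc]
        _ = P := by simp only [hvv, hP, Matrix.mul_assoc, Matrix.one_mul]
    have hPH : Pᴴ = P := by
      simp only [hP, Matrix.conjTranspose_mul, Matrix.conjTranspose_conjTranspose, hDD,
        Matrix.mul_assoc]
    have hPP : P * P = P := by
      calc P * P = M * v * (D * D * (vᴴ * (Mᴴ * M) * v) * (D * D)) * vᴴ * Mᴴ := by
            simp only [hP, Matrix.mul_assoc]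
        _ = P := by rw [hdiag, hDE]
    have h1 : 1 - P = (1 - P)ᴴ * (1 - P) := by
      rw [Matrix.conjTranspose_sub, hPH, Matrix.conjTranspose_one, Matrix.mul_sub, Matrix.sub_mul,
        Matrix.sub_mul, hPP]
      simp
    rw [hG, h1]
    exact Matrix.posSemidef_conjTranspose_mul_self _
  · have h1 : (v * D * vᴴ * Mᴴ * M).trace = (D * (vᴴ * (Mᴴ * M) * v)).trace := by
      calc (v * D * vᴴ * Mᴴ * M).trace = (v * (D * (vᴴ * (Mᴴ * M)))).trace := by
            simp only [Matrix.mul_assoc]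
        _ = _ := by
            rw [Matrix.trace_mul_comm]
            simp only [Matrix.mul_assoc]
    rw [h1, hdiag, hD, hE, Matrix.diagonal_mul_diagonal, Matrix.trace_diagonal, Complex.re_sum]
    refine Finset.sum_congr rfl fun i _ => ?_
    rw [← Complex.ofReal_inv, ← Complex.ofReal_mul, Complex.ofReal_re]
    change √(h.eigenvalues i) = _
    rcases (hpos i).eq_or_lt with h0 | h0
    · simp [← h0]
    · rw [inv_mul_eq_div, Real.div_sqrt]

theorem hsSq_mul_le {m k : Type} [Fintype m] [DecidableEq m] [Fintype k] {G : Matrix m m ℂ}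
    (hG : (1 - Gᴴ * G).PosSemidef) (X : Matrix m k ℂ) : hsSq (G * X) ≤ hsSq X := by
  have h := (hG.conjTranspose_mul_mul_same X).trace_nonneg
  have h1 : (Xᴴ * (1 - Gᴴ * G) * X).trace = ((hsSq X - hsSq (G * X) : ℝ) : ℂ) := by
    rw [Complex.ofReal_sub, hsSq_eq_trace, hsSq_eq_trace, Matrix.conjTranspose_mul,
      ← Matrix.trace_sub]
    congr 1
    simp only [Matrix.mul_sub, Matrix.sub_mul, Matrix.mul_one, Matrix.mul_assoc]
  rw [h1, Complex.zero_le_real] at h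
  linarith

/-- Testing against the contraction that attains the trace norm leaves two Hilbert–Schmidt inner
products. Cauchy–Schwarz applies to each, and the contraction does not increase the norms. -/
theorem traceNorm_symmetrized_le {m k : Type} [Fintype m] [DecidableEq m] [Fintype k]
    (X Y : Matrix m k ℂ) :
    traceNorm ((1 / 2 : ℂ) • (X * Yᴴ + Y * Xᴴ)) ≤ √(hsSq X) * √(hsSq Y) := by
  obtain ⟨G, hG, h⟩ := exists_contraction_traceNorm ((1 / 2 : ℂ) • (X * Yᴴ + Y * Xᴴ))
  have h1 := trace_mul_conjTranspose_re_le (G * X) Y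
  have h2 := trace_mul_conjTranspose_re_le (G * Y) X
  have h3 : √(hsSq (G * X)) * √(hsSq Y) ≤ √(hsSq X) * √(hsSq Y) := by
    gcongr; exact hsSq_mul_le hG X
  have h4 : √(hsSq (G * Y)) * √(hsSq X) ≤ √(hsSq Y) * √(hsSq X) := by
    gcongr; exact hsSq_mul_le hG Y
  rw [h, Matrix.mul_smul, Matrix.trace_smul, Matrix.mul_add, Matrix.trace_add, ← Matrix.mul_assoc,
    ← Matrix.mul_assoc]
  have h5 : ((1 / 2 : ℂ) • ((G * X * Yᴴ).trace + (G * Y * Xᴴ).trace)).re =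
      1 / 2 * ((G * X * Yᴴ).trace.re + (G * Y * Xᴴ).trace.re) := by
    rw [smul_eq_mul, show (1 / 2 : ℂ) = ((1 / 2 : ℝ) : ℂ) by push_cast; rfl,
      Complex.re_ofReal_mul, Complex.add_re]
  rw [h5]
  linarith [mul_comm √(hsSq X) √(hsSq Y)]

/-- The matrices `A k * C` side by side. -/
def sideBySide {κ n m : Type} [Fintype m] (A : κ → Matrix n m ℂ) (C : Matrix m m ℂ) :
    Matrix n (κ × m) ℂ :=
  Matrix.of fun x p => (A p.1 * C) x p.2

/-- With `ρ = C * Cᴴ`, this writes a Kraus sum as one product of two matrices, ready for a single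
use of Cauchy–Schwarz. -/
theorem sideBySide_mul_conjTranspose {κ n m : Type} [Fintype κ] [Fintype m]
    (A B : κ → Matrix n m ℂ) (C : Matrix m m ℂ) :
    sideBySide A C * (sideBySide B C)ᴴ = ∑ k, A k * (C * Cᴴ) * (B k)ᴴ := by
  have h (k : κ) : A k * (C * Cᴴ) * (B k)ᴴ = (A k * C) * (B k * C)ᴴ := by
    rw [Matrix.conjTranspose_mul]
    simp only [Matrix.mul_assoc]
  simp only [h]
  ext x y
  simp only [sideBySide, Matrix.mul_apply, Matrix.conjTranspose_apply, Matrix.of_apply,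
    Fintype.sum_prod_type, Matrix.sum_apply]

theorem hsSq_sideBySide {κ n m : Type} [Fintype κ] [Fintype n] [Fintype m]
    (A : κ → Matrix n m ℂ) (C : Matrix m m ℂ) :
    (hsSq (sideBySide A C) : ℂ) = ((∑ k, (A k)ᴴ * A k) * (C * Cᴴ)).trace := by
  have h : hsSq (sideBySide A C) = ∑ k, hsSq (A k * C) := by
    simp only [hsSq, sideBySide, Matrix.of_apply, Fintype.sum_prod_type]
    rw [Finset.sum_comm]
  rw [h, Finset.sum_mul, Matrix.trace_sum]
  push_cast
  refine Finset.sum_congr rfl fun k _ => ?_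
  rw [hsSq_eq_trace, Matrix.conjTranspose_mul, Matrix.mul_assoc, Matrix.trace_mul_comm]
  simp only [Matrix.mul_assoc]

/-- Two channels with Kraus operators `A k` and `B k` whose overlap `∑ k, (A k)ᴴ * B k` is a
multiple of the identity are close to each other. -/
theorem traceNorm_kraus_sub_le {κ n m : Type} [Fintype κ] [Fintype n] [DecidableEq n] [Fintype m]
    [DecidableEq m] {A B : κ → Matrix n m ℂ} {c : ℝ} {ρ : Matrix m m ℂ} (hρ : ρ.PosSemidef)
    (hA : ∑ k, (A k)ᴴ * A k = 1) (hB : ∑ k, (B k)ᴴ * B k = 1)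
    (hAB : ∑ k, (A k)ᴴ * B k = (c : ℂ) • 1) :
    traceNorm (∑ k, A k * ρ * (A k)ᴴ - ∑ k, B k * ρ * (B k)ᴴ) ≤
      2 * √(1 - c ^ 2) * ρ.trace.re := by
  obtain ⟨C, rfl⟩ : ∃ C : Matrix m m ℂ, ρ = C * Cᴴ := by
    open scoped MatrixOrder in
    obtain ⟨C, hC⟩ := CStarAlgebra.nonneg_iff_eq_star_mul_self.mp hρ.nonneg
    exact ⟨Cᴴ, by rw [hC, Matrix.conjTranspose_conjTranspose]; rfl⟩
  set t := hsSq C with ht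
  have htr : (C * Cᴴ).trace = (t : ℂ) := by rw [ht, hsSq_eq_trace, Matrix.trace_mul_comm]
  have hBA : ∑ k, (B k)ᴴ * A k = (c : ℂ) • 1 := by
    have := congrArg Matrix.conjTranspose hAB
    simpa [Matrix.conjTranspose_sum] using this
  -- The difference is polarized as `AρA† - BρB† = ((A-B)ρ(A+B)† + (A+B)ρ(A-B)†) / 2`. The two
  -- factors have squared norms `(2 - 2c) t` and `(2 + 2c) t`, whose product is `(2t)² (1 - c²)`.
  set X := sideBySide (fun k => A k - B k) C with hX
  set Y := sideBySide (fun k => A k + B k) C with hY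
  have hXn : hsSq X = (2 - 2 * c) * t := by
    rw [← Complex.ofReal_inj, hX, hsSq_sideBySide]
    have : ∑ k, (A k - B k)ᴴ * (A k - B k) = ((2 - 2 * c : ℝ) : ℂ) • (1 : Matrix m m ℂ) := by
      simp only [Matrix.conjTranspose_sub, Matrix.sub_mul, Matrix.mul_sub, Finset.sum_sub_distrib,
        hA, hB, hAB, hBA]
      push_cast
      module
    rw [this, Matrix.smul_mul, Matrix.one_mul, Matrix.trace_smul, htr]
    push_cast
    simp
  have hYn : hsSq Y = (2 + 2 * c) * t := by
    rw [← Complex.ofReal_inj, hY, hsSq_sideBySide]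
    have : ∑ k, (A k + B k)ᴴ * (A k + B k) = ((2 + 2 * c : ℝ) : ℂ) • (1 : Matrix m m ℂ) := by
      simp only [Matrix.conjTranspose_add, Matrix.add_mul, Matrix.mul_add, Finset.sum_add_distrib,
        hA, hB, hAB, hBA]
      push_cast
      module
    rw [this, Matrix.smul_mul, Matrix.one_mul, Matrix.trace_smul, htr]
    push_cast
    simp
  have hM : ∑ k, A k * (C * Cᴴ) * (A k)ᴴ - ∑ k, B k * (C * Cᴴ) * (B k)ᴴ =
      (1 / 2 : ℂ) • (X * Yᴴ + Y * Xᴴ) := by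
    rw [hX, hY, sideBySide_mul_conjTranspose, sideBySide_mul_conjTranspose]
    simp only [Matrix.conjTranspose_add, Matrix.conjTranspose_sub, Matrix.add_mul, Matrix.mul_add,
      Matrix.sub_mul, Matrix.mul_sub, Finset.sum_add_distrib, Finset.sum_sub_distrib]
    module
  rw [hM, htr, Complex.ofReal_re]
  refine (traceNorm_symmetrized_le X Y).trans (le_of_eq ?_)
  rw [← Real.sqrt_mul (hsSq_nonneg X), hXn, hYn,
    show (2 - 2 * c) * t * ((2 + 2 * c) * t) = (2 * t) ^ 2 * (1 - c ^ 2) by ring,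
    Real.sqrt_mul (sq_nonneg _), Real.sqrt_sq (mul_nonneg zero_le_two (hsSq_nonneg C))]
  ring

/-! ### Kraus operators of tensor powers and Pauli identities. -/

theorem tens_smul {ι m k : Type} [Fintype ι] (a : ι → ℂ) (A : ι → Matrix k m ℂ) :
    (tens fun i => a i • A i) = (∏ i, a i) • tens A := by
  ext x y
  simp [tens, Finset.prod_mul_distrib]

theorem sum_tens {ι κ m k : Type} [Fintype ι] [DecidableEq ι] [Fintype κ]
    (M : κ → Matrix k m ℂ) :
    ∑ p : ι → κ, tens (fun i => M (p i)) = tens fun _ => ∑ a, M a := by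
  ext x y
  simp [tens, Matrix.sum_apply, prod_sum_pi]

/-- A product observable on the environments of independent channels pulls back to the product of
the individual pull-backs. -/
theorem sum_tens_smul_tens {ι κ m k : Type} [Fintype ι] [DecidableEq ι] [Fintype κ]
    (w : ι → Matrix κ κ ℂ) (M : κ → κ → Matrix k m ℂ) :
    ∑ p : ι → κ, ∑ q : ι → κ, tens w p q • tens (fun i => M (p i) (q i)) =
      tens fun i => ∑ a, ∑ a', w i a a' • M a a' := by
  ext x y
  simp [tens, Matrix.sum_apply, prod_sum_sum_pi, Finset.prod_mul_distrib]

theorem PauliOp.mat_eq_smul_tens {n : ℕ} (P : PauliOp n) :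
    P.mat = P.phase • tens fun j => (P.label j).mat := rfl

theorem conjBy_apply {m k : Type} [Fintype m] (A : Matrix k m ℂ) (ρ : Matrix m m ℂ) :
    conjBy A ρ = A * ρ * Aᴴ := rfl

theorem conjBy_comp {m k l : Type} [Fintype m] [Fintype k] (A : Matrix l k ℂ) (B : Matrix k m ℂ) :
    conjBy A ∘ₗ conjBy B = conjBy (A * B) := by
  ext1 ρ
  simp only [LinearMap.comp_apply, conjBy_apply, Matrix.conjTranspose_mul, Matrix.mul_assoc]

theorem conjBy_one {m : Type} [Fintype m] [DecidableEq m] :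
    conjBy (1 : Matrix m m ℂ) = LinearMap.id := by
  ext1 ρ
  simp [conjBy_apply]

theorem conjBy_sqrt_smul {m k : Type} [Fintype m] {a : ℝ} (ha : 0 ≤ a) (A : Matrix k m ℂ) :
    conjBy ((√a : ℂ) • A) = (a : ℂ) • conjBy A := by
  ext1 ρ
  simp only [LinearMap.smul_apply, conjBy_apply, Matrix.conjTranspose_smul, Matrix.smul_mul,
    Matrix.mul_smul, smul_smul]
  congr 1
  rw [← starRingEnd_apply, Complex.conj_ofReal, ← Complex.ofReal_mul, Real.mul_self_sqrt ha]

theorem conjBy_single_apply {m k : Type} [Fintype m] [DecidableEq m] (A : Matrix k m ℂ)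
    (y y' : m) (x x' : k) :
    conjBy A (Matrix.single y y' 1) x x' = A x y * star (A x' y') := by
  rw [conjBy_apply, Matrix.mul_apply]
  simp [Matrix.mul_apply, Matrix.single_apply, ite_and]

theorem tpow_sum_conjBy {m k ι κ : Type} [Fintype m] [DecidableEq m] [Fintype ι] [DecidableEq ι]
    [Fintype κ] (K : κ → Matrix k m ℂ) :
    tpow ι (∑ a, conjBy (K a)) = ∑ p : ι → κ, conjBy (tens fun i => K (p i)) := by
  refine superOp_ext fun y y' x x' => ?_
  rw [tpow_single]
  simp only [LinearMap.sum_apply, Matrix.sum_apply, conjBy_single_apply, prod_sum_pi, tens,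
    Matrix.of_apply, star_prod, Finset.prod_mul_distrib]

theorem Pauli.Z_mat_mul_self : Pauli.Z.mat * Pauli.Z.mat = 1 := by
  ext i j; fin_cases i <;> fin_cases j <;> simp [Pauli.mat, Matrix.mul_apply]

theorem Pauli.X_mat_mul_self : Pauli.X.mat * Pauli.X.mat = 1 := by
  ext i j; fin_cases i <;> fin_cases j <;> simp [Pauli.mat, Matrix.mul_apply]

theorem Pauli.Z_mul_X : Pauli.Z.mat * Pauli.X.mat = -(Pauli.X.mat * Pauli.Z.mat) := by
  ext i j; fin_cases i <;> fin_cases j <;> simp [Pauli.mat, Matrix.mul_apply]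

theorem Pauli.mat_conjTranspose (P : Pauli) : P.matᴴ = P.mat := by
  cases P <;> ext i j <;> fin_cases i <;> fin_cases j <;>
    simp [Pauli.mat, Matrix.conjTranspose_apply]

/-! ### Phase records and their behaviour under noise and encoding. -/

/-- The channel `Φ` has Kraus operators `K` and a Hermitian unitary observable `u` of the
environment that acts on the input as `c • Z`: the environment knows the value of `Z` with
bias `c`. -/
def HasPhaseRecord {k : Type} [Fintype k] (Φ : SuperOp (Fin 2) k) (c : ℝ) : Prop :=
  ∃ (κ : Type) (_ : Fintype κ) (_ : DecidableEq κ) (K : κ → Matrix k (Fin 2) ℂ)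
    (u : Matrix κ κ ℂ),
    Φ = ∑ a, conjBy (K a) ∧ ∑ a, (K a)ᴴ * K a = 1 ∧ uᴴ = u ∧ u * u = 1 ∧
      ∑ a, ∑ a', u a a' • ((K a)ᴴ * K a') = (c : ℂ) • Pauli.Z.mat

theorem HasPhaseRecord.relabel_comp {k l : Type} [Fintype k] [Fintype l] {Φ : SuperOp (Fin 2) k}
    {c : ℝ} (h : HasPhaseRecord Φ c) (e : k ≃ l) : HasPhaseRecord (relabel e ∘ₗ Φ) c := by
  obtain ⟨κ, _, _, K, u, rfl, hK, hu, huu, hc⟩ := h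
  have hmul (a a' : κ) : ((K a).submatrix e.symm id)ᴴ * (K a').submatrix e.symm id =
      (K a)ᴴ * K a' := by
    rw [Matrix.conjTranspose_submatrix, Matrix.submatrix_mul_equiv, Matrix.submatrix_id_id]
  refine ⟨κ, _, ‹_›, fun a => (K a).submatrix e.symm id, u, ?_, ?_, hu, huu, ?_⟩
  · ext ρ x x'
    simp only [LinearMap.comp_apply, LinearMap.sum_apply, Matrix.sum_apply, relabel_apply,
      conjBy_apply]
    rfl
  · simpa only [hmul] using hK
  · simpa only [hmul] using hc

/-- The environment is a fair coin independent of the input, and `u` is its sign. A one-dimensional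
environment would not do: its `u` is `±1`, which pulls back to `±1` rather than to a multiple of
`Z`. -/
theorem hasPhaseRecord_id : HasPhaseRecord (LinearMap.id : SuperOp (Fin 2) (Fin 2)) 0 := by
  have h2 : ((√(1 / 2) : ℝ) : ℂ) * ((√(1 / 2) : ℝ) : ℂ) = 1 / 2 := by
    rw [← Complex.ofReal_mul, Real.mul_self_sqrt (by norm_num)]
    norm_num
  have hs : star ((√(1 / 2) : ℝ) : ℂ) = ((√(1 / 2) : ℝ) : ℂ) := Complex.conj_ofReal _
  refine ⟨Fin 2, inferInstance, inferInstance, fun _ => ((√(1 / 2) : ℝ) : ℂ) • 1, Pauli.Z.mat,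
    ?_, ?_, Pauli.mat_conjTranspose _, Pauli.Z_mat_mul_self, ?_⟩
  · rw [Fin.sum_univ_two, conjBy_sqrt_smul (by norm_num), conjBy_one, ← add_smul]
    norm_num
  · simp only [Fin.sum_univ_two, Matrix.conjTranspose_smul, hs, Matrix.conjTranspose_one,
      Matrix.smul_mul, Matrix.one_mul, smul_smul, h2, ← add_smul]
    norm_num
  · simp [Fin.sum_univ_two, Pauli.mat]

/-- The environment of the composite is the old one together with a flag qubit that labels the Kraus
operators `F i`. The new observable is `u ⊗ A + 1 ⊗ B`: `A` reads the flag jointly with the old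
record, `B` reads the flag alone. Its square is `1` because `A` and `B` anticommute and their
squares sum to `1`. -/
theorem HasPhaseRecord.comp {k : Type} [Fintype k] {Φ : SuperOp (Fin 2) k} {c c' : ℝ}
    (h : HasPhaseRecord Φ c) {F : Fin 2 → Matrix (Fin 2) (Fin 2) ℂ} {A B : Matrix (Fin 2) (Fin 2) ℂ}
    (hF : ∑ i, (F i)ᴴ * F i = 1) (hA : Aᴴ = A) (hB : Bᴴ = B) (hAB : A * A + B * B = 1)
    (hanti : A * B + B * A = 0)
    (hc' : ∑ i, ∑ j, (A i j * c) • ((F i)ᴴ * Pauli.Z.mat * F j) +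
      ∑ i, ∑ j, B i j • ((F i)ᴴ * F j) = (c' : ℂ) • Pauli.Z.mat) :
    HasPhaseRecord (Φ ∘ₗ ∑ i, conjBy (F i)) c' := by
  obtain ⟨κ, _, _, K, u, rfl, hK, hu, huu, hc⟩ := h
  have hmul (p q : κ × Fin 2) : (K p.1 * F p.2)ᴴ * (K q.1 * F q.2) =
      (F p.2)ᴴ * ((K p.1)ᴴ * K q.1) * F q.2 := by
    simp only [Matrix.conjTranspose_mul, Matrix.mul_assoc]
  refine ⟨κ × Fin 2, inferInstance, inferInstance, fun p => K p.1 * F p.2, u ⊗ₖ A + 1 ⊗ₖ B,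
    ?_, ?_, ?_, ?_, ?_⟩
  · rw [Fintype.sum_prod_type]
    simp only [← conjBy_comp]
    ext1 ρ
    simp only [LinearMap.comp_apply, LinearMap.sum_apply, map_sum]
    exact Finset.sum_comm
  · simp only [hmul]
    rw [Fintype.sum_prod_type_right]
    simp only [← Finset.sum_mul, ← Finset.mul_sum, hK, Matrix.mul_one, hF]
  · rw [Matrix.conjTranspose_add, Matrix.conjTranspose_kronecker, Matrix.conjTranspose_kronecker,
      hu, hA, hB, Matrix.conjTranspose_one]
  · rw [Matrix.add_mul, Matrix.mul_add, Matrix.mul_add, ← Matrix.mul_kronecker_mul,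
      ← Matrix.mul_kronecker_mul, ← Matrix.mul_kronecker_mul, ← Matrix.mul_kronecker_mul, huu,
      Matrix.one_mul, Matrix.mul_one, Matrix.one_mul]
    calc 1 ⊗ₖ (A * A) + u ⊗ₖ (A * B) + (u ⊗ₖ (B * A) + 1 ⊗ₖ (B * B))
        = 1 ⊗ₖ (A * A + B * B) + u ⊗ₖ (A * B + B * A) := by
          rw [Matrix.kronecker_add, Matrix.kronecker_add]; abel
      _ = 1 := by rw [hAB, hanti, Matrix.kronecker_zero, add_zero, Matrix.one_kronecker_one]
  · have h1 : ∑ p : κ × Fin 2, ∑ q : κ × Fin 2, (u ⊗ₖ A) p q •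
        ((F p.2)ᴴ * ((K p.1)ᴴ * K q.1) * F q.2) =
        ∑ i, ∑ j, (A i j * c) • ((F i)ᴴ * Pauli.Z.mat * F j) := by
      simp only [Fintype.sum_prod_type_right]
      refine Finset.sum_congr rfl fun i _ => ?_
      rw [Finset.sum_comm]
      refine Finset.sum_congr rfl fun j _ => ?_
      have := congrArg (fun M => A i j • ((F i)ᴴ * M * F j)) hc
      simp only [Matrix.mul_smul, Matrix.smul_mul, smul_smul, Finset.mul_sum, Finset.sum_mul,
        Finset.smul_sum] at this
      rw [← this]
      refine Finset.sum_congr rfl fun a _ => Finset.sum_congr rfl fun a' _ => ?_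
      rw [Matrix.kroneckerMap_apply, mul_comm]
    have h2 : ∑ p : κ × Fin 2, ∑ q : κ × Fin 2, ((1 : Matrix κ κ ℂ) ⊗ₖ B) p q •
        ((F p.2)ᴴ * ((K p.1)ᴴ * K q.1) * F q.2) = ∑ i, ∑ j, B i j • ((F i)ᴴ * F j) := by
      simp only [Fintype.sum_prod_type_right]
      refine Finset.sum_congr rfl fun i _ => ?_
      rw [Finset.sum_comm]
      refine Finset.sum_congr rfl fun j _ => ?_
      simp only [Matrix.kroneckerMap_apply, Matrix.one_apply, ite_mul, one_mul, zero_mul, ite_smul,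
        zero_smul, Finset.sum_ite_eq, Finset.mem_univ, if_true]
      rw [← Finset.smul_sum, ← Finset.sum_mul, ← Finset.mul_sum, hK, Matrix.mul_one]
    simp only [hmul, Matrix.add_apply, add_smul, Finset.sum_add_distrib]
    rw [h1, h2, hc']

theorem conjTranspose_sqrt_smul {m k : Type} (a : ℝ) (A : Matrix k m ℂ) :
    ((√a : ℂ) • A)ᴴ = (√a : ℂ) • Aᴴ := by
  rw [Matrix.conjTranspose_smul, ← starRingEnd_apply, Complex.conj_ofReal]

/-- The observable `u ⊗ Z` multiplies the record by `-1` exactly when the flag reports a flip. This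
cancels the sign in `X Z X = -Z`, so no bias is lost. -/
theorem HasPhaseRecord.comp_bitFlip {k : Type} [Fintype k] {Φ : SuperOp (Fin 2) k} {c p : ℝ}
    (h : HasPhaseRecord Φ c) (hp : p ∈ Set.Icc (0 : ℝ) 1) :
    HasPhaseRecord (Φ ∘ₗ bitFlip p) c := by
  have h1 : ((√(1 - p) : ℝ) : ℂ) * ((√(1 - p) : ℝ) : ℂ) = 1 - p := by
    rw [← Complex.ofReal_mul, Real.mul_self_sqrt (by linarith [hp.2])]; push_cast; rfl
  have h2 : ((√p : ℝ) : ℂ) * ((√p : ℝ) : ℂ) = p := by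
    rw [← Complex.ofReal_mul, Real.mul_self_sqrt hp.1]
  have hF : bitFlip p = ∑ i : Fin 2, conjBy
      ((![(√(1 - p) : ℂ) • 1, (√p : ℂ) • Pauli.X.mat] : Fin 2 → Matrix (Fin 2) (Fin 2) ℂ) i) := by
    simp only [Fin.sum_univ_two, Matrix.cons_val_zero, Matrix.cons_val_one]
    rw [conjBy_sqrt_smul (by linarith [hp.2]), conjBy_sqrt_smul hp.1, conjBy_one]
    rfl
  rw [hF]
  refine h.comp (A := Pauli.Z.mat) (B := 0) ?_ (Pauli.mat_conjTranspose _) (by simp)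
    (by rw [Pauli.Z_mat_mul_self]; simp) (by simp) ?_
  · simp only [Fin.sum_univ_two, Matrix.cons_val_zero, Matrix.cons_val_one,
      conjTranspose_sqrt_smul, Matrix.smul_mul, Matrix.mul_smul, smul_smul, h1, h2,
      Pauli.mat_conjTranspose, Pauli.X_mat_mul_self, Matrix.conjTranspose_one, Matrix.one_mul,
      ← add_smul]
    norm_num
  · have h3 : Pauli.X.mat * (Pauli.Z.mat * Pauli.X.mat) = -Pauli.Z.mat := by
      rw [Pauli.Z_mul_X, Matrix.mul_neg, ← Matrix.mul_assoc,
        Pauli.X_mat_mul_self, Matrix.one_mul]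
    simp only [Fin.sum_univ_two, Matrix.cons_val_zero, Matrix.cons_val_one,
      conjTranspose_sqrt_smul, Matrix.smul_mul, Matrix.mul_smul, smul_smul, mul_assoc, h1, h2,
      Pauli.mat_conjTranspose, Matrix.conjTranspose_one, Matrix.one_mul, h3, Matrix.mul_one]
    simp only [Pauli.mat, Matrix.of_apply, Matrix.cons_val', Matrix.cons_val_zero,
      Matrix.cons_val_one, Matrix.zero_apply, zero_smul, zero_mul, add_zero, zero_add, one_mul,
      Matrix.cons_val_fin_one]
    module

/-- The observable is `α (u ⊗ Z) + β (1 ⊗ X)`. The first term carries the old record, weighted by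
`(1 - p) - p`; the second detects the coherence `√(1 - p) √p` between the Kraus operators `1` and
`Z`, whose products are themselves multiples of `Z`. -/
theorem HasPhaseRecord.comp_phaseFlip {k : Type} [Fintype k] {Φ : SuperOp (Fin 2) k} {c p α β : ℝ}
    (h : HasPhaseRecord Φ c) (hp : p ∈ Set.Icc (0 : ℝ) 1) (hαβ : α ^ 2 + β ^ 2 = 1) :
    HasPhaseRecord (Φ ∘ₗ phaseFlip p) (α * c * (1 - 2 * p) + β * (2 * √(1 - p) * √p)) := by
  have h1 : ((√(1 - p) : ℝ) : ℂ) * ((√(1 - p) : ℝ) : ℂ) = 1 - p := by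
    rw [← Complex.ofReal_mul, Real.mul_self_sqrt (by linarith [hp.2])]; push_cast; rfl
  have h2 : ((√p : ℝ) : ℂ) * ((√p : ℝ) : ℂ) = p := by
    rw [← Complex.ofReal_mul, Real.mul_self_sqrt hp.1]
  have hF : phaseFlip p = ∑ i : Fin 2, conjBy
      ((![(√(1 - p) : ℂ) • 1, (√p : ℂ) • Pauli.Z.mat] : Fin 2 → Matrix (Fin 2) (Fin 2) ℂ) i) := by
    simp only [Fin.sum_univ_two, Matrix.cons_val_zero, Matrix.cons_val_one]
    rw [conjBy_sqrt_smul (by linarith [hp.2]), conjBy_sqrt_smul hp.1, conjBy_one]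
    rfl
  have hαβ' : ((α * α + β * β : ℝ) : ℂ) = 1 := by
    rw [show α * α + β * β = 1 by linarith [hαβ, sq α, sq β]]; simp
  rw [hF]
  refine h.comp (A := (α : ℂ) • Pauli.Z.mat) (B := (β : ℂ) • Pauli.X.mat) ?_ ?_ ?_ ?_ ?_ ?_
  · simp only [Fin.sum_univ_two, Matrix.cons_val_zero, Matrix.cons_val_one,
      conjTranspose_sqrt_smul, Matrix.smul_mul, Matrix.mul_smul, smul_smul, h1, h2,
      Pauli.mat_conjTranspose, Pauli.Z_mat_mul_self, Matrix.conjTranspose_one, Matrix.one_mul,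
      ← add_smul]
    norm_num
  · rw [Matrix.conjTranspose_smul, Pauli.mat_conjTranspose, ← starRingEnd_apply,
      Complex.conj_ofReal]
  · rw [Matrix.conjTranspose_smul, Pauli.mat_conjTranspose, ← starRingEnd_apply,
      Complex.conj_ofReal]
  · simp only [Matrix.smul_mul, Matrix.mul_smul, smul_smul, Pauli.Z_mat_mul_self,
      Pauli.X_mat_mul_self, ← add_smul]
    rw [← Complex.ofReal_mul, ← Complex.ofReal_mul, ← Complex.ofReal_add, hαβ', one_smul]
  · simp only [Matrix.smul_mul, Matrix.mul_smul, Pauli.Z_mul_X]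
    module
  · simp only [Fin.sum_univ_two, Matrix.cons_val_zero, Matrix.cons_val_one,
      conjTranspose_sqrt_smul, Matrix.smul_mul, Matrix.mul_smul, smul_smul, mul_assoc, h1, h2,
      Pauli.mat_conjTranspose, Matrix.conjTranspose_one, Matrix.one_mul, Pauli.Z_mat_mul_self,
      Matrix.mul_one]
    simp only [Pauli.mat, Matrix.of_apply, Matrix.cons_val', Matrix.cons_val_zero,
      Matrix.cons_val_one, zero_smul, zero_mul, add_zero, zero_add,
      Matrix.cons_val_fin_one, Matrix.smul_apply, smul_eq_mul, mul_one, mul_zero]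
    push_cast
    module

/-- Measuring `u` at each `Z` site of `L` and nothing elsewhere pulls back to `c ^ weight` times the
tensor part of `L`. Together with the phase this is `L`, and `Vᴴ * L * V = Z`. -/
theorem hasPhaseRecord_tensor {b : ℕ} {V : Matrix (Fin b → Fin 2) (Fin 2) ℂ} (hV : Vᴴ * V = 1)
    {L : PauliOp b} (hL : L.IsZType) (hVL : IsLogicalZ V L) {k : Type} [Fintype k]
    {Φ : SuperOp (Fin 2) k} {c : ℝ} (h : HasPhaseRecord Φ c) :
    HasPhaseRecord (tpow (Fin b) Φ ∘ₗ conjBy V) (c ^ L.weight) := by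
  obtain ⟨κ, _, _, K, u, rfl, hK, hu, huu, hc⟩ := h
  set w : Fin b → Matrix κ κ ℂ := fun i => if L.label i = Pauli.Z then u else 1 with hw
  have hVLV : Vᴴ * L.mat * V = Pauli.Z.mat := by
    rw [Matrix.mul_assoc, ← hVL, ← Matrix.mul_assoc, hV, Matrix.one_mul]
  -- The phase has to be real for the new observable to be Hermitian. It is, since `Z` is a nonzero
  -- Hermitian matrix equal to the phase times a Hermitian compression.
  have hηstar : star L.phase = L.phase := by
    have h1 : L.phase • (Vᴴ * (tens fun j => (L.label j).mat) * V) = Pauli.Z.mat := by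
      rw [← hVLV, PauliOp.mat_eq_smul_tens, Matrix.mul_smul, Matrix.smul_mul]
    have h2 := congrArg Matrix.conjTranspose h1
    rw [Matrix.conjTranspose_smul, Pauli.mat_conjTranspose, Matrix.conjTranspose_mul,
      Matrix.conjTranspose_mul, Matrix.conjTranspose_conjTranspose, tens_conjTranspose] at h2
    simp only [Pauli.mat_conjTranspose] at h2
    rw [← Matrix.mul_assoc, ← h1] at h2
    refine smul_left_injective ℂ ?_ h2
    intro h0
    rw [h0, smul_zero] at h1
    have := congrFun (congrFun h1 0) 0
    simp [Pauli.mat] at this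
  have hηη : L.phase * L.phase = 1 := by
    have hre : L.phase = (L.phase.re : ℂ) := (Complex.conj_eq_iff_re.mp hηstar).symm
    have h4 : L.phase.re ^ 4 = 1 := by
      have := L.phase_pow
      rw [hre] at this
      exact_mod_cast this
    rw [hre, ← Complex.ofReal_mul, ← Complex.ofReal_one, Complex.ofReal_inj]
    nlinarith [sq_nonneg L.phase.re]
  have hmul (p q : Fin b → κ) : (tens (fun i => K (p i)) * V)ᴴ * (tens (fun i => K (q i)) * V) =
      Vᴴ * (tens fun i => (K (p i))ᴴ * K (q i)) * V := by
    rw [← tens_mul, ← tens_conjTranspose]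
    simp only [Matrix.conjTranspose_mul, Matrix.mul_assoc]
  refine ⟨Fin b → κ, inferInstance, inferInstance, fun p => tens (fun i => K (p i)) * V,
    L.phase • tens w, ?_, ?_, ?_, ?_, ?_⟩
  · rw [tpow_sum_conjBy]
    simp only [← conjBy_comp]
    ext1 ρ
    simp only [LinearMap.comp_apply, LinearMap.sum_apply]
  · simp only [hmul]
    rw [← Matrix.sum_mul, ← Matrix.mul_sum, sum_tens fun a => (K a)ᴴ * K a, hK, tens_one,
      Matrix.mul_one, hV]
  · rw [Matrix.conjTranspose_smul, hηstar, tens_conjTranspose]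
    congr 2
    ext1 i
    simp only [hw]
    split_ifs <;> simp [hu]
  · rw [Matrix.smul_mul, Matrix.mul_smul, smul_smul, hηη, one_smul, tens_mul, ← tens_one]
    congr 1
    ext1 i
    simp only [hw]
    split_ifs <;> simp [huu]
  · have h1 (i : Fin b) : ∑ a, ∑ a', w i a a' • ((K a)ᴴ * K a') =
        (if L.label i ≠ Pauli.I then (c : ℂ) else 1) • (L.label i).mat := by
      simp only [hw]
      rcases hL i with h0 | h0
      · simp [h0, Matrix.one_apply, ite_smul, hK, Pauli.mat]
      · simp [h0, hc]
    simp only [hmul, Matrix.smul_apply, smul_eq_mul, mul_smul, ← Finset.smul_sum]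
    have h2 : ∑ p : Fin b → κ, ∑ q : Fin b → κ,
        tens w p q • (Vᴴ * (tens fun i => (K (p i))ᴴ * K (q i)) * V) =
        Vᴴ * ((c : ℂ) ^ L.weight • tens fun j => (L.label j).mat) * V := by
      have := sum_tens_smul_tens w fun a a' => (K a)ᴴ * K a'
      simp only [h1, tens_smul, Finset.prod_ite, Finset.prod_const, one_pow,
        mul_one] at this
      rw [PauliOp.weight, ← this]
      simp only [Matrix.mul_sum, Matrix.sum_mul, Matrix.mul_smul, Matrix.smul_mul]
    rw [h2, ← hVLV, PauliOp.mat_eq_smul_tens, Complex.ofReal_pow]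
    simp only [Matrix.mul_smul, Matrix.smul_mul]
    rw [smul_comm]

/-! ### From a phase record to bounds on the trace and diamond norms. -/

/-- Unitary freedom of Kraus representations, in a form that serves both for the channel and for its
normalization. -/
theorem sum_unitary_remix {κ M : Type} [Fintype κ] [DecidableEq κ] [AddCommGroup M] [Module ℂ M]
    {u : Matrix κ κ ℂ} (hu : uᴴ * u = 1) (f : κ → κ → M) :
    ∑ k, ∑ l, ∑ l', (star (u k l) * u k l') • f l l' = ∑ l, f l l := by
  have h (l l' : κ) : ∑ k, star (u k l) * u k l' = (1 : Matrix κ κ ℂ) l l' := by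
    rw [← hu, Matrix.mul_apply]
    rfl
  rw [Finset.sum_comm]
  refine Finset.sum_congr rfl fun l _ => ?_
  rw [Finset.sum_comm]
  simp only [← Finset.sum_smul, h, Matrix.one_apply, ite_smul, one_smul, zero_smul,
    Finset.sum_ite_eq, Finset.mem_univ, if_true]

/-- Mixing the flipped Kraus operators `A l * Z` by `u` does not change their channel, but makes
their overlap with `A` equal to `c • Z * Z = c • 1`. -/
theorem traceNorm_sub_flip_le {κ n m : Type} [Fintype κ] [DecidableEq κ] [Fintype n]
    [DecidableEq n] [Fintype m] [DecidableEq m] {A : κ → Matrix n m ℂ} {u : Matrix κ κ ℂ}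
    {Z ρ : Matrix m m ℂ} {c : ℝ} (hρ : ρ.PosSemidef) (hA : ∑ k, (A k)ᴴ * A k = 1) (hu : uᴴ = u)
    (huu : u * u = 1) (hZ : Zᴴ = Z) (hZZ : Z * Z = 1)
    (hc : ∑ k, ∑ l, u k l • ((A k)ᴴ * A l) = (c : ℂ) • Z) :
    traceNorm (∑ k, A k * ρ * (A k)ᴴ - ∑ k, A k * (Z * ρ * Z) * (A k)ᴴ) ≤
      2 * √(1 - c ^ 2) * ρ.trace.re := by
  set B : κ → Matrix n m ℂ := fun k => ∑ l, u k l • (A l * Z) with hB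
  have huu' : uᴴ * u = 1 := by rw [hu, huu]
  have hBB : ∑ k, (B k)ᴴ * B k = 1 := by
    have h := sum_unitary_remix huu' fun l l' => (A l * Z)ᴴ * (A l' * Z)
    have h1 : ∑ l, (A l * Z)ᴴ * (A l * Z) = Z * (∑ l, (A l)ᴴ * A l) * Z := by
      simp only [Matrix.mul_sum, Matrix.sum_mul, Matrix.conjTranspose_mul, hZ, Matrix.mul_assoc]
    rw [h1, hA, Matrix.mul_one, hZZ] at h
    rw [← h]
    refine Finset.sum_congr rfl fun k _ => ?_
    simp only [hB, Matrix.conjTranspose_sum, Matrix.sum_mul, Matrix.mul_sum,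
      Matrix.conjTranspose_smul, Matrix.smul_mul, Matrix.mul_smul, Finset.smul_sum, smul_smul]
    rw [Finset.sum_comm]
    simp only [mul_comm]
  have hBρ : ∑ k, A k * (Z * ρ * Z) * (A k)ᴴ = ∑ k, B k * ρ * (B k)ᴴ := by
    have h := sum_unitary_remix huu' fun l l' => (A l' * Z) * ρ * (A l * Z)ᴴ
    have h1 : ∑ l, (A l * Z) * ρ * (A l * Z)ᴴ = ∑ k, A k * (Z * ρ * Z) * (A k)ᴴ := by
      simp only [Matrix.conjTranspose_mul, hZ, Matrix.mul_assoc]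
    rw [← h1, ← h]
    refine Finset.sum_congr rfl fun k _ => ?_
    simp only [hB, Matrix.conjTranspose_sum, Matrix.sum_mul, Matrix.mul_sum,
      Matrix.conjTranspose_smul, Matrix.smul_mul, Matrix.mul_smul, Finset.smul_sum, smul_smul]
  have hAB : ∑ k, (A k)ᴴ * B k = (c : ℂ) • 1 := by
    have h1 : ∑ k, (A k)ᴴ * B k = (∑ k, ∑ l, u k l • ((A k)ᴴ * A l)) * Z := by
      simp only [hB, Matrix.mul_sum, Matrix.sum_mul, Matrix.mul_smul, Matrix.smul_mul,
        Matrix.mul_assoc]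
    rw [h1, hc, Matrix.smul_mul, hZZ]
  rw [hBρ]
  exact traceNorm_kraus_sub_le hρ hA hBB hAB

theorem tensorId_conjBy {m k : Type} [Fintype m] (r : Type) [Fintype r] [DecidableEq r]
    (A : Matrix k m ℂ) (ρ : Matrix (m × r) (m × r) ℂ) :
    tensorId r (conjBy A) ρ = (A ⊗ₖ (1 : Matrix r r ℂ)) * ρ * (A ⊗ₖ (1 : Matrix r r ℂ))ᴴ := by
  ext x x'
  change (A * (Matrix.of fun a a' => ρ (a, x.2) (a', x'.2)) * Aᴴ) x.1 x'.1 = _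
  simp only [Matrix.mul_apply, Fintype.sum_prod_type, Matrix.kroneckerMap_apply, Matrix.one_apply,
    Matrix.conjTranspose_apply, Matrix.of_apply, mul_ite, mul_one, mul_zero, ite_mul, zero_mul,
    Finset.sum_ite_eq, Finset.mem_univ, if_true, apply_ite star, star_zero]

theorem tensorId_comp {m k l : Type} (r : Type) (Ψ : SuperOp k l) (Φ : SuperOp m k)
    (ρ : Matrix (m × r) (m × r) ℂ) :
    tensorId r (Ψ ∘ₗ Φ) ρ = tensorId r Ψ (tensorId r Φ ρ) := rfl

theorem tensorId_sum {m k κ : Type} [Fintype κ] (r : Type) (Φ : κ → SuperOp m k)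
    (ρ : Matrix (m × r) (m × r) ℂ) :
    tensorId r (∑ a, Φ a) ρ = ∑ a, tensorId r (Φ a) ρ := by
  ext x x'
  simp only [Matrix.sum_apply]
  change (∑ a, Φ a) _ _ _ = _
  rw [LinearMap.sum_apply, Matrix.sum_apply]
  rfl

theorem sub_comp_dephase {k : Type} (Φ : SuperOp (Fin 2) k) :
    Φ - Φ ∘ₗ dephase = (1 / 2 : ℂ) • (Φ - Φ ∘ₗ conjBy Pauli.Z.mat) := by
  ext1 ρ
  simp only [dephase, LinearMap.sub_apply, LinearMap.comp_apply, LinearMap.smul_apply,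
    LinearMap.add_apply, LinearMap.id_apply, map_smul, map_add]
  module

theorem HasPhaseRecord.traceNorm_tensorId_le {k : Type} [Fintype k] [DecidableEq k]
    {Φ : SuperOp (Fin 2) k} {c : ℝ} (h : HasPhaseRecord Φ c)
    {ρ : Matrix (Fin 2 × Fin 2) (Fin 2 × Fin 2) ℂ} (hρ : IsDensity ρ) :
    traceNorm (tensorId (Fin 2) (Φ - Φ ∘ₗ dephase) ρ) ≤ √(1 - c ^ 2) := by
  obtain ⟨κ, _, _, K, u, rfl, hK, hu, huu, hc⟩ := h
  set A : κ → Matrix (k × Fin 2) (Fin 2 × Fin 2) ℂ := fun a => K a ⊗ₖ 1 with hA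
  set Z : Matrix (Fin 2 × Fin 2) (Fin 2 × Fin 2) ℂ := Pauli.Z.mat ⊗ₖ 1 with hZ
  have hAA (a a' : κ) : (A a)ᴴ * A a' = ((K a)ᴴ * K a') ⊗ₖ (1 : Matrix (Fin 2) (Fin 2) ℂ) := by
    rw [hA, Matrix.conjTranspose_kronecker, ← Matrix.mul_kronecker_mul, Matrix.conjTranspose_one,
      Matrix.mul_one]
  have hZH : Zᴴ = Z := by
    rw [hZ, Matrix.conjTranspose_kronecker, Pauli.mat_conjTranspose, Matrix.conjTranspose_one]
  have hsum (M : κ → Matrix (Fin 2) (Fin 2) ℂ) : ∑ a, M a ⊗ₖ (1 : Matrix (Fin 2) (Fin 2) ℂ) =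
      (∑ a, M a) ⊗ₖ 1 := by
    ext x x'
    simp [Matrix.sum_apply, Finset.sum_mul]
  -- The factor `1 / 2` from dephasing is absorbed into the state, so homogeneity of the trace norm
  -- is not needed.
  have h1 : ((1 / 2 : ℂ) • ρ).PosSemidef := hρ.1.smul (by
    rw [one_div, ← Complex.ofReal_ofNat, ← Complex.ofReal_inv]
    exact Complex.zero_le_real.mpr (by norm_num))
  have h2 := traceNorm_sub_flip_le (A := A) (Z := Z) (c := c) h1
    (by simp only [hAA]; rw [hsum, hK, Matrix.one_kronecker_one]) hu huu hZH
    (by rw [hZ, ← Matrix.mul_kronecker_mul, Pauli.Z_mat_mul_self, Matrix.one_mul,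
      Matrix.one_kronecker_one])
    (by
      simp only [hAA, ← Matrix.smul_kronecker]
      simp only [hsum, hc]
      rw [Matrix.smul_kronecker])
  have h3 : ((1 / 2 : ℂ) • ρ).trace.re = 1 / 2 := by
    rw [Matrix.trace_smul, hρ.2]
    norm_num
  rw [h3] at h2
  have h4 : tensorId (Fin 2) ((∑ a, conjBy (K a)) - (∑ a, conjBy (K a)) ∘ₗ dephase) ρ =
      ∑ a, A a * ((1 / 2 : ℂ) • ρ) * (A a)ᴴ -
        ∑ a, A a * (Z * ((1 / 2 : ℂ) • ρ) * Z) * (A a)ᴴ := by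
    rw [sub_comp_dephase]
    change (1 / 2 : ℂ) • (tensorId (Fin 2) (∑ a, conjBy (K a)) ρ -
      tensorId (Fin 2) ((∑ a, conjBy (K a)) ∘ₗ conjBy Pauli.Z.mat) ρ) = _
    rw [tensorId_comp, tensorId_sum, tensorId_sum]
    simp only [tensorId_conjBy]
    rw [← hZ, hZH]
    simp only [Matrix.mul_smul, Matrix.smul_mul, ← Finset.smul_sum, smul_sub, hA]
  rw [h4]
  linarith

theorem HasPhaseRecord.diamondNorm_le {k : Type} [Fintype k] [DecidableEq k]
    {Φ : SuperOp (Fin 2) k} {c : ℝ} (h : HasPhaseRecord Φ c) :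
    diamondNorm (Φ - Φ ∘ₗ dephase) ≤ ENNReal.ofReal √(1 - c ^ 2) :=
  iSup₂_le fun _ hρ => ENNReal.ofReal_le_ofReal (h.traceNorm_tensorId_le hρ)

theorem plusState_posSemidef : plusState.PosSemidef := by
  have h : plusState = plusStateᴴ * plusState := by
    ext i j
    fin_cases i <;> fin_cases j <;>
      norm_num [plusState, Matrix.mul_apply, Matrix.conjTranspose_apply, map_ofNat]
  rw [h]
  exact Matrix.posSemidef_conjTranspose_mul_self _

theorem HasPhaseRecord.traceNorm_plus_sub_minus_le {k : Type} [Fintype k] [DecidableEq k]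
    {Φ : SuperOp (Fin 2) k} {c : ℝ} (h : HasPhaseRecord Φ c) :
    traceNorm (Φ plusState - Φ minusState) ≤ 2 * √(1 - c ^ 2) := by
  obtain ⟨κ, _, _, K, u, rfl, hK, hu, huu, hc⟩ := h
  have h1 := traceNorm_sub_flip_le plusState_posSemidef hK hu huu (Pauli.mat_conjTranspose _)
    Pauli.Z_mat_mul_self hc
  have h2 : Pauli.Z.mat * plusState * Pauli.Z.mat = minusState := by
    ext i j
    fin_cases i <;> fin_cases j <;> simp [plusState, minusState, Pauli.mat, Matrix.mul_apply]
  have h3 : plusState.trace.re = 1 := by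
    norm_num [plusState, Matrix.trace]
  rw [h2, h3, mul_one] at h1
  simpa only [LinearMap.sum_apply, conjBy_apply] using h1

/-! ### Decay of the defect `1 - c²` along the tree. -/

/-- Phase flips on the input improve the record of the environment. -/
theorem HasPhaseRecord.exists_comp_noise {k : Type} [Fintype k] {Φ : SuperOp (Fin 2) k}
    {c px pz : ℝ} (h : HasPhaseRecord Φ c) (hx : px ∈ Set.Icc (0 : ℝ) 1)
    (hz : pz ∈ Set.Icc (0 : ℝ) 1) :
    ∃ c' : ℝ, 1 - c' ^ 2 = (1 - 2 * pz) ^ 2 * (1 - c ^ 2) ∧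
      HasPhaseRecord (Φ ∘ₗ bitFlip px ∘ₗ phaseFlip pz) c' := by
  set a := c * (1 - 2 * pz) with ha
  set t := 2 * √(1 - pz) * √pz with ht
  have ht2 : t ^ 2 = 1 - (1 - 2 * pz) ^ 2 := by
    rw [ht, mul_pow, mul_pow, Real.sq_sqrt hz.1, Real.sq_sqrt (by linarith [hz.2])]
    ring
  -- The best unit vector `(α, β)` is parallel to `(a, t)`. Any unit vector serves if `(a, t)`
  -- vanishes.
  obtain ⟨α, β, hαβ, hc⟩ : ∃ α β : ℝ, α ^ 2 + β ^ 2 = 1 ∧ (α * a + β * t) ^ 2 = a ^ 2 + t ^ 2 := by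
    rcases eq_or_ne (a ^ 2 + t ^ 2) 0 with h0 | h0
    · have ha0 : a = 0 := by nlinarith [sq_nonneg a, sq_nonneg t]
      have ht0 : t = 0 := by nlinarith [sq_nonneg a, sq_nonneg t]
      exact ⟨1, 0, by norm_num, by simp [ha0, ht0]⟩
    · have hr : √(a ^ 2 + t ^ 2) ^ 2 = a ^ 2 + t ^ 2 := Real.sq_sqrt (by positivity)
      refine ⟨a / √(a ^ 2 + t ^ 2), t / √(a ^ 2 + t ^ 2), ?_, ?_⟩
      · rw [div_pow, div_pow, hr, ← add_div, div_self h0]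
      · rw [show a / √(a ^ 2 + t ^ 2) * a + t / √(a ^ 2 + t ^ 2) * t =
          (a ^ 2 + t ^ 2) / √(a ^ 2 + t ^ 2) by ring, div_pow, hr, sq (a ^ 2 + t ^ 2),
          mul_div_assoc, div_self h0, mul_one]
  refine ⟨α * c * (1 - 2 * pz) + β * t, ?_, ?_⟩
  swap
  · rw [← LinearMap.comp_assoc]
    exact (h.comp_bitFlip hx).comp_phaseFlip hz hαβ
  rw [mul_assoc, ← ha, hc, ht2, ha]
  ring

theorem exists_hasPhaseRecord_treeChannel {b : ℕ} {V : Matrix (Fin b → Fin 2) (Fin 2) ℂ}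
    (hV : Vᴴ * V = 1) {L : PauliOp b} (hL : L.IsZType) (hVL : IsLogicalZ V L) {px pz : ℝ}
    (hx : px ∈ Set.Icc (0 : ℝ) 1) (hz : pz ∈ Set.Icc (0 : ℝ) 1) (T : ℕ) :
    ∃ c : ℝ, 1 - c ^ 2 ≤ ((L.weight : ℝ) * (1 - 2 * pz) ^ 2) ^ T ∧
      HasPhaseRecord (treeChannel V (bitFlip px ∘ₗ phaseFlip pz) T) c := by
  induction T with
  | zero => exact ⟨0, by simp, hasPhaseRecord_id.relabel_comp (rootEquiv b)⟩
  | succ T ih =>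
    obtain ⟨c, hc, h⟩ := ih
    obtain ⟨c', hc', h'⟩ := h.exists_comp_noise hx hz
    refine ⟨c' ^ L.weight, ?_, ?_⟩
    · have h1 : 1 + (L.weight : ℝ) * -(1 - c' ^ 2) ≤ (1 + -(1 - c' ^ 2)) ^ L.weight :=
        one_add_mul_le_pow (by nlinarith [sq_nonneg c']) _
      have h2 : (1 + -(1 - c' ^ 2)) ^ L.weight = (c' ^ L.weight) ^ 2 := by
        rw [← pow_mul, mul_comm L.weight 2, pow_mul]
        congr 1
        ring
      have h3 : (L.weight : ℝ) * (1 - 2 * pz) ^ 2 * (1 - c ^ 2) ≤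
          (L.weight : ℝ) * (1 - 2 * pz) ^ 2 * ((L.weight : ℝ) * (1 - 2 * pz) ^ 2) ^ T :=
        mul_le_mul_of_nonneg_left hc (by positivity)
      rw [pow_succ' ((L.weight : ℝ) * _)]
      rw [h2, hc'] at h1
      linarith
    · rw [treeChannel_succ]
      exact (hasPhaseRecord_tensor hV hL hVL h').relabel_comp _

/-- The record of the environment, in terms of the decay rate of the tree. -/
theorem exists_hasPhaseRecord_sqrt_le {b : ℕ} {V : Matrix (Fin b → Fin 2) (Fin 2) ℂ}
    (hV : Vᴴ * V = 1) {L : PauliOp b} (hL : L.IsZType) (hVL : IsLogicalZ V L) {px pz : ℝ}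
    (hx : px ∈ Set.Icc (0 : ℝ) 1) (hz : pz ∈ Set.Icc (0 : ℝ) 1) (T : ℕ) :
    ∃ c : ℝ, √(1 - c ^ 2) ≤ (√(L.weight : ℝ) * |1 - 2 * pz|) ^ T ∧
      HasPhaseRecord (treeChannel V (bitFlip px ∘ₗ phaseFlip pz) T) c := by
  obtain ⟨c, hc, h⟩ := exists_hasPhaseRecord_treeChannel hV hL hVL hx hz T
  refine ⟨c, Real.sqrt_le_iff.mpr ⟨by positivity, ?_⟩, h⟩
  rwa [← pow_mul, mul_comm T 2, pow_mul, mul_pow, Real.sq_sqrt (Nat.cast_nonneg _), sq_abs]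

/-! ### Encoders as isometries. -/

/-- The computational basis state `|a 0 ⋯ 0⟩`. -/
def padZero (b : ℕ) (a : Fin 2) : Fin b → Fin 2 := fun j => if j.val = 0 then a else 0

/-- The isometry `|ψ⟩ ↦ |ψ⟩ |0 ⋯ 0⟩`. -/
def ancilla (b : ℕ) : Matrix (Fin b → Fin 2) (Fin 2) ℂ :=
  Matrix.of fun x a => if x = padZero b a then 1 else 0

theorem mul_ancilla_apply {b : ℕ} (U : Matrix (Fin b → Fin 2) (Fin b → Fin 2) ℂ)
    (x : Fin b → Fin 2) (a : Fin 2) : (U * ancilla b) x a = U x (padZero b a) := by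
  simp [Matrix.mul_apply, ancilla]

theorem encoder_eq_mul_ancilla {b : ℕ} (U : Matrix (Fin b → Fin 2) (Fin b → Fin 2) ℂ) :
    encoder U = U * ancilla b := by
  ext x a
  rw [mul_ancilla_apply]
  rfl

theorem padZero_injective {b : ℕ} (hb : 1 ≤ b) : Function.Injective (padZero b) := by
  intro a a' h
  have := congrFun h ⟨0, hb⟩
  simpa [padZero] using this

theorem ancilla_conjTranspose_mul_self {b : ℕ} (hb : 1 ≤ b) : (ancilla b)ᴴ * ancilla b = 1 := by
  ext a a'
  rw [Matrix.mul_apply]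
  simp [ancilla, Matrix.conjTranspose_apply, Matrix.one_apply, (padZero_injective hb).eq_iff]
  simp [eq_comm]

theorem encoder_conjTranspose_mul_self {b : ℕ} (hb : 1 ≤ b)
    {U : Matrix (Fin b → Fin 2) (Fin b → Fin 2) ℂ} (hU : Uᴴ * U = 1) :
    (encoder U)ᴴ * encoder U = 1 := by
  rw [encoder_eq_mul_ancilla, Matrix.conjTranspose_mul, Matrix.mul_assoc, ← Matrix.mul_assoc Uᴴ,
    hU, Matrix.one_mul, ancilla_conjTranspose_mul_self hb]

/-- An operator on the first qubit, tensored with operators that fix `|0⟩`. -/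
theorem tens_mul_ancilla {b : ℕ} (hb : 1 ≤ b) {A : Fin b → Matrix (Fin 2) (Fin 2) ℂ}
    (hA : ∀ j : Fin b, j ≠ ⟨0, hb⟩ → ∀ y, A j y 0 = if y = 0 then 1 else 0) :
    tens A * ancilla b = ancilla b * A ⟨0, hb⟩ := by
  have hne {j : Fin b} (hj : j ≠ ⟨0, hb⟩) : j.val ≠ 0 := fun h => hj (Fin.ext h)
  ext y a
  rw [mul_ancilla_apply, Matrix.mul_apply]
  simp only [tens, Matrix.of_apply, ancilla]
  by_cases hy : y = padZero b (y ⟨0, hb⟩)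
  · have h1 (a' : Fin 2) : y = padZero b a' ↔ a' = y ⟨0, hb⟩ := by
      constructor
      · rintro rfl; simp [padZero]
      · rintro rfl; exact hy
    simp only [h1, ite_mul, one_mul, zero_mul, Finset.sum_ite_eq', Finset.mem_univ, if_true]
    rw [Finset.prod_eq_single ⟨0, hb⟩]
    · simp [padZero]
    · intro j _ hj
      have h2 : y j = 0 := by rw [hy]; simp [padZero, hne hj]
      rw [show padZero b a j = 0 by simp [padZero, hne hj], hA j hj, if_pos h2]
    · simp
  · have h1 (a' : Fin 2) : y ≠ padZero b a' := by
      rintro rfl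
      exact hy (by simp [padZero])
    obtain ⟨j, hj⟩ := Function.ne_iff.mp hy
    have hj0 : j ≠ ⟨0, hb⟩ := by
      rintro rfl
      exact hj (by simp [padZero])
    rw [Finset.prod_eq_zero (Finset.mem_univ j)]
    · simp [h1]
    · rw [show padZero b a j = 0 by simp [padZero, hne hj0], hA j hj0, if_neg]
      simpa [padZero, hne hj0] using hj

/-! ### Existence of an encoder with a logical operator of `Z` type. -/

instance Pauli.finite : Finite Pauli :=
  Finite.of_injective
    (fun P : Pauli => match P with | .I => (0 : Fin 4) | .X => 1 | .Y => 2 | .Z => 3)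
    (by intro P Q; cases P <;> cases Q <;> simp)

theorem finite_fourth_roots : {z : ℂ | z ^ 4 = 1}.Finite := by
  refine Set.Finite.subset (Set.toFinite {1, -1, Complex.I, -Complex.I}) fun z hz => ?_
  have h : (z - 1) * ((z + 1) * ((z - Complex.I) * (z + Complex.I))) = 0 := by
    have : z ^ 4 = 1 := hz
    linear_combination this - (z ^ 2 - 1) * Complex.I_sq
  simp only [mul_eq_zero, sub_eq_zero, add_eq_zero_iff_eq_neg] at h
  simpa using h

instance PauliOp.finite (n : ℕ) : Finite (PauliOp n) := by
  have := finite_fourth_roots.to_subtype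
  refine Finite.of_injective
    (fun P : PauliOp n => ((⟨P.phase, P.phase_pow⟩ : {z : ℂ | z ^ 4 = 1}), P.label)) ?_
  rintro ⟨p, hp, l⟩ ⟨q, hq, m⟩ h
  simpa using h

/-- The inverse of a Clifford unitary maps Pauli operators to Pauli operators. -/
theorem IsClifford.exists_conj_eq {n : ℕ} {U : Matrix (Fin n → Fin 2) (Fin n → Fin 2) ℂ}
    (hU : IsClifford U) (P : PauliOp n) : ∃ Q : PauliOp n, P.mat * U = U * Q.mat := by
  have hUU : Uᴴ * U = 1 := Matrix.mem_unitaryGroup_iff'.mp hU.1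
  set S : Set (Matrix (Fin n → Fin 2) (Fin n → Fin 2) ℂ) := Set.range PauliOp.mat
  have hS : S.Finite := Set.finite_range _
  have hfin : Finite S := hS.to_subtype
  let f : S → S := fun M => ⟨U * M.1 * Uᴴ, by
    obtain ⟨M, P, rfl⟩ := M
    obtain ⟨Q, hQ⟩ := hU.2 P
    exact ⟨Q, hQ.symm⟩⟩
  have hcancel (M : Matrix (Fin n → Fin 2) (Fin n → Fin 2) ℂ) : Uᴴ * (U * M * Uᴴ) * U = M := by
    calc Uᴴ * (U * M * Uᴴ) * U = (Uᴴ * U) * M * (Uᴴ * U) := by simp only [Matrix.mul_assoc]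
      _ = M := by rw [hUU, Matrix.one_mul, Matrix.mul_one]
  have hf : Function.Injective f := by
    intro M N h
    have h1 : U * M.1 * Uᴴ = U * N.1 * Uᴴ := congrArg Subtype.val h
    apply Subtype.ext
    rw [← hcancel M.1, h1, hcancel]
  -- Conjugation by `U` is an injective self-map of the finite set of Pauli matrices, hence
  -- surjective.
  obtain ⟨⟨M, Q, rfl⟩, hQ⟩ := Finite.injective_iff_surjective.mp hf ⟨P.mat, P, rfl⟩
  refine ⟨Q, ?_⟩
  have h1 : U * Q.mat * Uᴴ = P.mat := congrArg Subtype.val hQ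
  rw [← h1, Matrix.mul_assoc, hUU, Matrix.mul_one]

/-- The tensor product of `Z` on the qubits in `S`. -/
def zString {n : ℕ} (S : Finset (Fin n)) : PauliOp n where
  phase := 1
  phase_pow := one_pow 4
  label j := if j ∈ S then Pauli.Z else Pauli.I

theorem zString_mat {n : ℕ} (S : Finset (Fin n)) :
    (zString S).mat = Matrix.diagonal fun x => ∏ j ∈ S, (if x j = 0 then 1 else -1 : ℂ) := by
  have hmat (j : Fin n) : ((zString S).label j).mat =
      Matrix.diagonal fun a => if j ∈ S then (if a = 0 then 1 else -1 : ℂ) else 1 := by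
    by_cases hj : j ∈ S
    · ext a a'
      fin_cases a <;> fin_cases a' <;> simp [zString, hj, Pauli.mat]
    · simp [zString, hj, Pauli.mat]
  ext x y
  rw [PauliOp.mat_eq_smul_tens]
  simp only [hmat, tens, Matrix.smul_apply, Matrix.of_apply, Matrix.diagonal_apply,
    Finset.prod_ite_zero, Finset.mem_univ, true_imp_iff]
  simp [zString, funext_iff]

/-- Walsh–Fourier inversion on bit strings: summing the characters at `x` and `x₀` over all `S`
factorizes into `∏ (1 ± 1)`, which is `2 ^ n` if `x = x₀` and `0` otherwise. -/
theorem eq_zero_of_walsh_eq_zero {n : ℕ} {g : (Fin n → Fin 2) → ℂ}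
    (h : ∀ S : Finset (Fin n), ∑ x, (∏ j ∈ S, (if x j = 0 then 1 else -1 : ℂ)) * g x = 0)
    (x₀ : Fin n → Fin 2) : g x₀ = 0 := by
  have h1 : ∑ S : Finset (Fin n), (∏ j ∈ S, (if x₀ j = 0 then 1 else -1 : ℂ)) *
      ∑ x, (∏ j ∈ S, (if x j = 0 then 1 else -1 : ℂ)) * g x = 0 := by
    simp only [h, mul_zero, Finset.sum_const_zero]
  have h2 (x : Fin n → Fin 2) : ∑ S : Finset (Fin n), (∏ j ∈ S, (if x₀ j = 0 then 1 else -1 : ℂ)) *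
      ∏ j ∈ S, (if x j = 0 then 1 else -1 : ℂ) = if x = x₀ then 2 ^ n else 0 := by
    simp only [← Finset.prod_mul_distrib]
    rw [← Finset.powerset_univ, ← Finset.prod_add_one]
    have h3 (a a' : Fin 2) : (if a = 0 then 1 else -1 : ℂ) * (if a' = 0 then 1 else -1 : ℂ) + 1 =
        if a' = a then 2 else 0 := by
      fin_cases a <;> fin_cases a' <;> norm_num
    simp only [h3, Finset.prod_ite_zero, Finset.mem_univ, true_imp_iff]
    simp [funext_iff]
  simp only [Finset.mul_sum, ← mul_assoc] at h1
  rw [Finset.sum_comm] at h1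
  simp only [← Finset.sum_mul, h2, ite_mul, zero_mul, Finset.sum_ite_eq', Finset.mem_univ,
    if_true] at h1
  simpa using h1

/-- An isometry from a qubit cannot hide the qubit from all diagonal operators. -/
theorem exists_zString_not_scalar {n : ℕ} {V : Matrix (Fin n → Fin 2) (Fin 2) ℂ}
    (hV : Vᴴ * V = 1) : ∃ S : Finset (Fin n), (Vᴴ * (zString S).mat * V) 0 1 ≠ 0 ∨
      (Vᴴ * (zString S).mat * V) 0 0 ≠ (Vᴴ * (zString S).mat * V) 1 1 := by
  by_contra! hcon
  have hentry (S : Finset (Fin n)) (a a' : Fin 2) : (Vᴴ * (zString S).mat * V) a a' =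
      ∑ x, (∏ j ∈ S, (if x j = 0 then 1 else -1 : ℂ)) * (star (V x a) * V x a') := by
    rw [zString_mat, Matrix.mul_apply]
    refine Finset.sum_congr rfl fun x _ => ?_
    rw [Matrix.mul_diagonal, Matrix.conjTranspose_apply]
    ring
  have h01 := eq_zero_of_walsh_eq_zero fun S => by rw [← hentry S 0 1]; exact (hcon S).1
  have hdiag := eq_zero_of_walsh_eq_zero
    (g := fun x => star (V x 0) * V x 0 - star (V x 1) * V x 1) fun S => by
      simp only [mul_sub, Finset.sum_sub_distrib]
      rw [← hentry S 0 0, ← hentry S 1 1, (hcon S).2, sub_self]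
  -- If all compressions were scalar, the two columns of `V` would have disjoint supports and equal
  -- moduli at each `x`, so they would vanish.
  have h0 (x : Fin n → Fin 2) : V x 0 = 0 := by
    by_contra hne
    have h1 := h01 x
    have h2 := hdiag x
    rcases mul_eq_zero.mp h1 with h | h
    · exact hne (star_eq_zero.mp h)
    · simp [h, hne] at h2
  have := congrFun (congrFun hV 0) 0
  simp [Matrix.mul_apply, Matrix.conjTranspose_apply, h0] at this

theorem inv_sqrt_two_mul_self : ((√2 : ℝ) : ℂ)⁻¹ * ((√2 : ℝ) : ℂ)⁻¹ = 1 / 2 := by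
  rw [← mul_inv, ← Complex.ofReal_mul, Real.mul_self_sqrt zero_le_two]
  norm_num

/-- The Clifford is the Hadamard-type reflection `(Q + Z) / √2`, which exchanges `Q` and `Z`. The
signs `f` and labels `g` tabulate its action on all four Pauli matrices. -/
theorem Pauli.exists_clifford_of_table {Q : Pauli} {f : Pauli → ℂ} {g : Pauli → Pauli}
    (hf : ∀ P, f P ^ 4 = 1)
    (hQ : Q.mat * (Q.mat + Pauli.Z.mat) = (Q.mat + Pauli.Z.mat) * Pauli.Z.mat)
    (hQQ : (Q.mat + Pauli.Z.mat) * (Q.mat + Pauli.Z.mat) = (2 : ℂ) • 1)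
    (h : ∀ P : Pauli, (Q.mat + Pauli.Z.mat) * P.mat * (Q.mat + Pauli.Z.mat) =
      (2 * f P) • (g P).mat) :
    ∃ C : Matrix (Fin 2) (Fin 2) ℂ, C * Cᴴ = 1 ∧ Q.mat * C = C * Pauli.Z.mat ∧
      ∀ P : Pauli, ∃ (ε : ℂ) (P' : Pauli), ε ^ 4 = 1 ∧ C * P.mat * Cᴴ = ε • P'.mat := by
  have hC : (((√2 : ℝ) : ℂ)⁻¹ • (Q.mat + Pauli.Z.mat))ᴴ =
      ((√2 : ℝ) : ℂ)⁻¹ • (Q.mat + Pauli.Z.mat) := by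
    rw [Matrix.conjTranspose_smul, ← starRingEnd_apply, map_inv₀, Complex.conj_ofReal,
      Matrix.conjTranspose_add, Pauli.mat_conjTranspose, Pauli.mat_conjTranspose]
  refine ⟨((√2 : ℝ) : ℂ)⁻¹ • (Q.mat + Pauli.Z.mat), ?_, ?_, fun P => ⟨f P, g P, hf P, ?_⟩⟩
  · rw [hC, Matrix.smul_mul, Matrix.mul_smul, smul_smul, inv_sqrt_two_mul_self, hQQ, smul_smul]
    norm_num
  · rw [Matrix.mul_smul, Matrix.smul_mul, hQ]
  · rw [hC, Matrix.smul_mul, Matrix.smul_mul, Matrix.mul_smul, smul_smul, inv_sqrt_two_mul_self, h,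
      smul_smul]
    congr 1
    ring

/-- For each nontrivial Pauli matrix there is a Clifford unitary that conjugates `Z` to it. -/
theorem Pauli.exists_clifford {Q : Pauli} (hQ : Q ≠ Pauli.I) :
    ∃ C : Matrix (Fin 2) (Fin 2) ℂ, C * Cᴴ = 1 ∧ Q.mat * C = C * Pauli.Z.mat ∧
      ∀ P : Pauli, ∃ (ε : ℂ) (P' : Pauli), ε ^ 4 = 1 ∧ C * P.mat * Cᴴ = ε • P'.mat := by
  cases Q with
  | I => exact absurd rfl hQ
  | X =>
    refine Pauli.exists_clifford_of_table
      (f := fun | .I => 1 | .X => 1 | .Y => -1 | .Z => 1)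
      (g := fun | .I => .I | .X => .Z | .Y => .Y | .Z => .X) ?_ ?_ ?_ ?_
    · rintro (_ | _ | _ | _) <;> norm_num
    · ext i j
      fin_cases i <;> fin_cases j <;> simp [Pauli.mat, Matrix.mul_apply]
    · ext i j
      fin_cases i <;> fin_cases j <;> norm_num [Pauli.mat, Matrix.mul_apply]
    · rintro (_ | _ | _ | _) <;> ext i j <;> fin_cases i <;> fin_cases j <;>
        simp [Pauli.mat, Matrix.mul_apply] <;> ring
  | Y =>
    refine Pauli.exists_clifford_of_table
      (f := fun | .I => 1 | .X => -1 | .Y => 1 | .Z => 1)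
      (g := fun | .I => .I | .X => .X | .Y => .Z | .Z => .Y) ?_ ?_ ?_ ?_
    · rintro (_ | _ | _ | _) <;> norm_num
    · ext i j
      fin_cases i <;> fin_cases j <;> simp [Pauli.mat, Matrix.mul_apply]
    · ext i j
      fin_cases i <;> fin_cases j <;> norm_num [Pauli.mat, Matrix.mul_apply]
    · rintro (_ | _ | _ | _) <;> ext i j <;> fin_cases i <;> fin_cases j <;>
        simp [Pauli.mat, Matrix.mul_apply] <;> ring
  | Z => exact ⟨1, by simp, by simp, fun P => ⟨1, P, by norm_num, by simp⟩⟩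

theorem IsClifford.mul_tens {n : ℕ} {U : Matrix (Fin n → Fin 2) (Fin n → Fin 2) ℂ}
    (hU : IsClifford U) {C : Fin n → Matrix (Fin 2) (Fin 2) ℂ} (hC : ∀ j, C j * (C j)ᴴ = 1)
    (hCP : ∀ j, ∀ P : Pauli, ∃ (ε : ℂ) (P' : Pauli), ε ^ 4 = 1 ∧
      C j * P.mat * (C j)ᴴ = ε • P'.mat) : IsClifford (U * tens C) := by
  refine ⟨mul_mem hU.1 (Matrix.mem_unitaryGroup_iff.mpr ?_), fun P => ?_⟩
  · rw [Matrix.star_eq_conjTranspose, tens_conjTranspose, tens_mul]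
    simp only [hC, tens_one]
  · choose ε P' hε hP' using fun j => hCP j (P.label j)
    set R : PauliOp n := ⟨P.phase * ∏ j, ε j, by
      rw [mul_pow, ← Finset.prod_pow, P.phase_pow]; simp [hε], P'⟩ with hR
    obtain ⟨Q, hQ⟩ := hU.2 R
    refine ⟨Q, ?_⟩
    have h1 : tens C * P.mat * (tens C)ᴴ = R.mat := by
      rw [PauliOp.mat_eq_smul_tens, PauliOp.mat_eq_smul_tens, Matrix.mul_smul, Matrix.smul_mul,
        tens_conjTranspose, tens_mul, tens_mul]
      simp only [hP', tens_smul, smul_smul, hR]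
    rw [← hQ, ← h1]
    simp only [Matrix.conjTranspose_mul, Matrix.mul_assoc]

/-- Every stabilizer code on which one qubit is encoded has an encoder with a logical `Z` operator
of `Z` type. -/
theorem IsClifford.exists_encoder_isZType {b : ℕ} (hb : 1 ≤ b)
    {U : Matrix (Fin b → Fin 2) (Fin b → Fin 2) ℂ} (hU : IsClifford U) :
    ∃ U' : Matrix (Fin b → Fin 2) (Fin b → Fin 2) ℂ, IsClifford U' ∧
      codeSpace (encoder U') = codeSpace (encoder U) ∧
      ∃ L : PauliOp b, L.IsZType ∧ IsLogicalZ (encoder U') L := by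
  have hUU : Uᴴ * U = 1 := Matrix.mem_unitaryGroup_iff'.mp hU.1
  obtain ⟨S, hS⟩ := exists_zString_not_scalar (encoder_conjTranspose_mul_self hb hUU)
  obtain ⟨R, hR⟩ := hU.exists_conj_eq (zString S)
  have hentry (a a' : Fin 2) : ((encoder U)ᴴ * (zString S).mat * encoder U) a a' =
      R.mat (padZero b a) (padZero b a') := by
    have h1 : (encoder U)ᴴ * (zString S).mat * encoder U = (ancilla b)ᴴ * (R.mat * ancilla b) := by
      calc (encoder U)ᴴ * (zString S).mat * encoder U
          = (ancilla b)ᴴ * (Uᴴ * ((zString S).mat * U) * ancilla b) := by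
            simp only [encoder_eq_mul_ancilla, Matrix.conjTranspose_mul, Matrix.mul_assoc]
        _ = _ := by rw [hR, ← Matrix.mul_assoc Uᴴ, hUU, Matrix.one_mul]
    rw [h1, Matrix.mul_apply]
    simp only [mul_ancilla_apply]
    simp [ancilla, Matrix.conjTranspose_apply]
  have hRentry (a a' : Fin 2) : R.mat (padZero b a) (padZero b a') =
      (R.label ⟨0, hb⟩).mat a a' *
        (R.phase * ∏ j ∈ Finset.univ.erase ⟨0, hb⟩, (R.label j).mat 0 0) := by
    change R.phase * ∏ j, (R.label j).mat (padZero b a j) (padZero b a' j) = _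
    rw [← Finset.mul_prod_erase _ _ (Finset.mem_univ (⟨0, hb⟩ : Fin b))]
    have h1 : ∏ j ∈ Finset.univ.erase (⟨0, hb⟩ : Fin b),
        (R.label j).mat (padZero b a j) (padZero b a' j) =
        ∏ j ∈ Finset.univ.erase (⟨0, hb⟩ : Fin b), (R.label j).mat 0 0 := by
      refine Finset.prod_congr rfl fun j hj => ?_
      have hj0 : j.val ≠ 0 := fun h => (Finset.ne_of_mem_erase hj) (Fin.ext h)
      simp [padZero, hj0]
    rw [h1]
    simp only [padZero, if_true]
    ring
  simp only [hentry, hRentry] at hS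
  -- A non-scalar compression forces a nonzero ancilla factor, hence only `I` or `Z` on the
  -- ancillas, and a label other than `I` on the input qubit.
  have hne : ∏ j ∈ Finset.univ.erase (⟨0, hb⟩ : Fin b), (R.label j).mat 0 0 ≠ 0 := by
    intro h0
    simp [h0] at hS
  have hR0 : R.label ⟨0, hb⟩ ≠ Pauli.I := by
    intro h0
    simp [h0, Pauli.mat] at hS
  have hRj (j : Fin b) (hj : j ≠ ⟨0, hb⟩) (y : Fin 2) :
      (R.label j).mat y 0 = if y = 0 then 1 else 0 := by
    have h1 := Finset.prod_ne_zero_iff.mp hne j (Finset.mem_erase.mpr ⟨hj, Finset.mem_univ j⟩)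
    revert h1
    cases R.label j <;> fin_cases y <;> simp [Pauli.mat, Matrix.one_apply]
  obtain ⟨C, hCC, hC, hCP⟩ := Pauli.exists_clifford hR0
  set A : Fin b → Matrix (Fin 2) (Fin 2) ℂ := fun j => if j = ⟨0, hb⟩ then C else 1 with hA
  have hAanc : tens A * ancilla b = ancilla b * C := by
    rw [tens_mul_ancilla hb]
    · simp [hA]
    · intro j hj y
      simp [hA, hj, Matrix.one_apply]
  have hRanc : R.mat * ancilla b = R.phase • (ancilla b * (R.label ⟨0, hb⟩).mat) := by
    rw [PauliOp.mat_eq_smul_tens, Matrix.smul_mul, tens_mul_ancilla hb hRj]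
  have henc : encoder (U * tens A) = encoder U * C := by
    rw [encoder_eq_mul_ancilla, encoder_eq_mul_ancilla, Matrix.mul_assoc, hAanc, Matrix.mul_assoc]
  have hphase : R.phase ≠ 0 := by
    intro h0
    have := R.phase_pow
    simp [h0] at this
  refine ⟨U * tens A, hU.mul_tens ?_ ?_, ?_, ?_⟩
  · intro j
    simp only [hA]
    split_ifs
    · exact hCC
    · simp
  · intro j P
    simp only [hA]
    split_ifs
    · exact hCP P
    · exact ⟨1, P, by norm_num, by simp⟩
  · rw [henc, codeSpace, codeSpace, Matrix.mulVecLin_mul]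
    refine LinearMap.range_comp_of_range_eq_top _ (LinearMap.range_eq_top.mpr fun v => ?_)
    exact ⟨Cᴴ *ᵥ v, by rw [Matrix.mulVecLin_apply, Matrix.mulVec_mulVec, hCC, Matrix.one_mulVec]⟩
  · refine ⟨⟨R.phase⁻¹, by rw [inv_pow, R.phase_pow, inv_one], (zString S).label⟩, ?_, ?_⟩
    · intro j
      simp only [zString]
      split_ifs <;> simp
    · have h1 : (PauliOp.mat ⟨R.phase⁻¹, by rw [inv_pow, R.phase_pow, inv_one],
          (zString S).label⟩) = R.phase⁻¹ • (zString S).mat := by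
        rw [PauliOp.mat_eq_smul_tens, PauliOp.mat_eq_smul_tens]
        simp [zString]
      rw [IsLogicalZ, h1, henc, encoder_eq_mul_ancilla]
      calc U * ancilla b * C * Pauli.Z.mat
          = U * (ancilla b * (R.label ⟨0, hb⟩).mat) * C := by
            simp only [Matrix.mul_assoc, hC]
        _ = U * (R.phase⁻¹ • (R.mat * ancilla b)) * C := by
            rw [hRanc, smul_smul, inv_mul_cancel₀ hphase, one_smul]
        _ = R.phase⁻¹ • ((U * R.mat) * ancilla b * C) := by
            simp only [Matrix.mul_smul, Matrix.smul_mul, Matrix.mul_assoc]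
        _ = R.phase⁻¹ • (zString S).mat * (U * ancilla b * C) := by
            rw [← hR]
            simp only [Matrix.smul_mul, Matrix.mul_assoc]

end

/-! ### Threshold and conclusion. -/

theorem sqrt_mul_abs_lt_one {w p : ℝ} (h1 : (1 - 1 / √w) / 2 < p)
    (h2 : p < (1 + 1 / √w) / 2) : √w * |1 - 2 * p| < 1 := by
  rcases (Real.sqrt_nonneg w).eq_or_lt with h0 | h0
  -- If `√w = 0`, the product is zero and the bounds on `p` play no role.
  · simp [← h0]
  · have h : |1 - 2 * p| < 1 / √w := abs_lt.mpr ⟨by linarith, by linarith⟩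
    rwa [lt_div_iff₀ h0, mul_comm] at h

theorem proposition1 (b : ℕ) (hb : 1 ≤ b)
    (U : Matrix (Fin b → Fin 2) (Fin b → Fin 2) ℂ) (hU : IsClifford U) :
    -- the code of `U` has an encoder with a logical `Z` operator of `Z` type
    (∃ U' : Matrix (Fin b → Fin 2) (Fin b → Fin 2) ℂ, IsClifford U' ∧
      codeSpace (encoder U') = codeSpace (encoder U) ∧
      ∃ L : PauliOp b, L.IsZType ∧ IsLogicalZ (encoder U') L) ∧
    -- the bounds, for each such logical operator of the given encoder
    (∀ ZL : PauliOp b, ZL.IsZType → IsLogicalZ (encoder U) ZL →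
      ∀ px pz : ℝ, px ∈ Set.Icc (0 : ℝ) 1 → pz ∈ Set.Icc (0 : ℝ) 1 →
        (∀ T : ℕ, diamondNorm (stabilizerTree U px pz T - stabilizerTree U px pz T ∘ₗ dephase) ≤
          ENNReal.ofReal (√2 * (√(ZL.weight : ℝ) * |1 - 2 * pz|) ^ T)) ∧
        (∀ T : ℕ, traceNorm
            (stabilizerTree U px pz T plusState - stabilizerTree U px pz T minusState) ≤
          2 * √2 * (√(ZL.weight : ℝ) * |1 - 2 * pz|) ^ T) ∧
        ((1 - 1 / √(ZL.weight : ℝ)) / 2 < pz → pz < (1 + 1 / √(ZL.weight : ℝ)) / 2 →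
          √(ZL.weight : ℝ) * |1 - 2 * pz| < 1 ∧
          Filter.Tendsto (fun T : ℕ =>
              diamondNorm (stabilizerTree U px pz T - stabilizerTree U px pz T ∘ₗ dephase))
            Filter.atTop (nhds 0))) := by
  have hUU : Uᴴ * U = 1 := Matrix.mem_unitaryGroup_iff'.mp hU.1
  -- The phase record already gives both bounds without the factor `√2`; it enters only by weakening
  -- them.
  have hsqrt : 1 ≤ √2 := Real.one_le_sqrt.mpr one_le_two
  refine ⟨hU.exists_encoder_isZType hb, fun ZL hZ hVL px pz hx hz => ?_⟩
  have hrec := exists_hasPhaseRecord_sqrt_le (encoder_conjTranspose_mul_self hb hUU) hZ hVL hx hz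
  set r := √(ZL.weight : ℝ) * |1 - 2 * pz| with hr
  have hr0 : 0 ≤ r := by positivity
  have hdiamond (T : ℕ) : diamondNorm (stabilizerTree U px pz T - stabilizerTree U px pz T ∘ₗ
      dephase) ≤ ENNReal.ofReal (√2 * r ^ T) := by
    obtain ⟨c, hc, h⟩ := hrec T
    refine h.diamondNorm_le.trans (ENNReal.ofReal_le_ofReal (hc.trans ?_))
    exact le_mul_of_one_le_left (by positivity) hsqrt
  refine ⟨hdiamond, fun T => ?_, fun h1 h2 => ?_⟩
  · obtain ⟨c, hc, h⟩ := hrec T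
    refine h.traceNorm_plus_sub_minus_le.trans ?_
    rw [mul_assoc]
    exact mul_le_mul_of_nonneg_left
      (hc.trans (le_mul_of_one_le_left (by positivity) hsqrt)) zero_le_two
  · have hr1 : r < 1 := sqrt_mul_abs_lt_one h1 h2
    refine ⟨hr1, ?_⟩
    have hlim : Filter.Tendsto (fun T : ℕ => ENNReal.ofReal (√2 * r ^ T))
        Filter.atTop (nhds 0) := by
      have := (tendsto_pow_atTop_nhds_zero_of_lt_one hr0 hr1).const_mul √2
      rw [mul_zero] at this
      simpa using ENNReal.tendsto_ofReal this
    exact tendsto_of_tendsto_of_tendsto_of_le_of_le tendsto_const_nhds hlim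
      (fun _ => zero_le) hdiamond
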